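/- **Setting.** A binary decision diagram (BDD) of index $k\ge 1$ and size $n$ is a plane reduced ordered binary decision diagram: a set $Q$ of $n$ nodes containing two sinks $\bot,\top$, an index function $I:Q\to\{0,\dots,k\}$ with $I(\bot)=I(\top)=0$, a root $r$ with $I(r)=k$, and for every non-sink $\nu$ a low child $\delta(\nu,0)$ and a high child $\delta(\nu,1)$, such that $\delta(\nu,0)\ne\delta(\nu,1)$, $I(\delta(\nu,\alpha))<I(\nu)$, distinct non-sinks of equal index have different pairs of children, and $r$ is the only node without incoming edge. BDDs are considered up to isomorphism, and $N(n,k)$ is their number. The spine of a BDD is the plane binary tree, with indices on its nodes, formed by the tree edges of the depth-first search from the root (low child first), sinks omitted; $\mathcal T_{m,k}$ is the set of trees with $m$ nodes that are spines of BDDs of index $k$. The spine of a BDD of size $n$ thus lies in $\mathcal T_{n-2,k}$. For a node $\nu$ of a spine, the pool consists of the two sinks and the nodes that precede $\nu$ in preorder and have index less than $I(\nu)$; the pool profile $\boldsymbol p$ counts its elements by index, and the level rank $s$ is the number of nodes that precede $\nu$ in preorder and have index $I(\nu)$. The profile $\boldsymbol t$ of a subtree counts its nodes by index. **Pre-computation.**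 The recursive counting algorithm $\mathrm{count}(m,\boldsymbol p,s)$ splits a subtree with $m$ nodes, whose root has pool profile $\boldsymbol p$ and level rank $s$, into root, left and right subtree in all possible ways. It yields a dictionary giving, for every profile $\boldsymbol t$, the total weight (number of completions of the undefined transitions into those of a BDD) of the subtrees with profile $\boldsymbol t$. All the dictionaries are stored, and for each entry the list of the splits of positive weight that contribute to it. **Unranking algorithm.** Given $(n,k)$ and a rank, it determines the profile of the spine by sequential search in $\mathrm{count}(n-2,(2,0,\dots,0),0)$, with $k$ components in $(2,0,\dots,0)$. Then, recursively for each node, it determines the split by sequential search in the stored list for the target profile and distributes the remaining rank by Euclidean division over the left part and the right part (a subtree, or the choice of a missing child). Finally it completes the spine, taking the chosen elements of the lists of admissible children. Each comparison, subtraction or division of sizes, ranks and weights, each computation of a node number, and each choice of an element in a list of admissible children counts as one arithmetic operation. Reading the pre-computed tables and forming the lists of admissible children are not counted. **Proposition.** There is an absolute constant $C$ such that for all $k\ge1$ and all $n$: 1. For every rank $0\le r<N(n,k)$, the unranking algorithm outputs a BDD of index $k$ and size $n$ after at most $C\cdot n\cdot|\mathcal T_{n-2,k}|$ arithmetic operations.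 2. Every BDD of index $k$ and size $n$ is, up to isomorphism, the output for exactly one rank $r\in\{0,\dots,N(n,k)-1\}$. 3. If $N(n,k)>0$, drawing $r$ uniformly in $\{0,\dots,N(n,k)-1\}$ and unranking it outputs every BDD of index $k$ and size $n$ with probability $1/N(n,k)$, and always within $C\cdot n\cdot|\mathcal T_{n-2,k}|$ arithmetic operations. -/

import Mathlib

/-! ### Binary decision diagrams as automata -/

/-- The node set `Q = V ∪ {⊥, ⊤}`: the two sinks (`sink false` is `⊥`, `sink true` is `⊤`)
and the decision nodes `v : V`. -/
inductive Vertex (V : Type*) where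
  | sink (b : Bool)
  | node (v : V)
deriving DecidableEq

/-- The nodes of `V` renamed along `f`; the sinks are fixed. -/
def Vertex.map {V W : Type*} (f : V → W) : Vertex V → Vertex W
  | .sink b => .sink b
  | .node v => .node (f v)

/-- The data `(Q, I, r, δ)`: `idx` is the index function on the decision nodes, and `δ v false`,
`δ v true` are the low and the high child of `v`. -/
structure Automaton (V : Type*) where
  idx : V → ℕ
  root : Vertex V
  δ : V → Bool → Vertex V

/-- The index function on all nodes; both sinks have index `0`. -/
def Automaton.index {V : Type*} (A : Automaton V) : Vertex V → ℕ
  | .sink _ => 0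
  | .node v => A.idx v

/-- `A` is a reduced ordered binary decision diagram of index `k`. (Acyclicity of the underlying
graph is a consequence of `decreasing`.) -/
structure IsBDD {V : Type*} (k : ℕ) (A : Automaton V) : Prop where
  idx_le : ∀ v, A.idx v ≤ k
  root_index : A.index A.root = k
  low_ne_high : ∀ v, A.δ v false ≠ A.δ v true
  unshared : ∀ u v, u ≠ v → A.idx u = A.idx v →
    A.δ u false ≠ A.δ v false ∨ A.δ u true ≠ A.δ v true
  decreasing : ∀ v α, A.index (A.δ v α) < A.idx v
  unique_source : ∀ q, (∀ v α, A.δ v α ≠ q) ↔ q = A.root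

/-- Isomorphism of automata. Two diagrams that differ only by the names of their decision nodes
are the same diagram. -/
def Isom {V W : Type*} (A : Automaton V) (B : Automaton W) : Prop :=
  ∃ e : V ≃ W, (∀ v, B.idx (e v) = A.idx v) ∧ B.root = A.root.map e ∧
    ∀ v α, B.δ (e v) α = (A.δ v α).map e

theorem Vertex.map_map {U V W : Type*} (f : U → V) (g : V → W) (q : Vertex U) :
    (q.map f).map g = q.map (g ∘ f) := by
  cases q <;> rfl

theorem Vertex.map_eq_self {V : Type*} (f : V → V) (hf : ∀ v, f v = v) (q : Vertex V) :
    q.map f = q := by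
  cases q <;> simp [Vertex.map, hf]

theorem Isom.refl {V : Type*} (A : Automaton V) : Isom A A :=
  ⟨Equiv.refl V, fun _ => rfl, (Vertex.map_eq_self _ (fun _ => rfl) _).symm,
    fun _ _ => (Vertex.map_eq_self _ (fun _ => rfl) _).symm⟩

theorem Isom.symm {V W : Type*} {A : Automaton V} {B : Automaton W} (h : Isom A B) :
    Isom B A := by
  obtain ⟨e, h1, h2, h3⟩ := h
  refine ⟨e.symm, fun w => ?_, ?_, fun w α => ?_⟩
  · rw [← h1, e.apply_symm_apply]
  · rw [h2, Vertex.map_map, Vertex.map_eq_self _ (fun v => by simp)]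
  · have := h3 (e.symm w) α
    rw [e.apply_symm_apply] at this
    rw [this, Vertex.map_map, Vertex.map_eq_self _ (fun v => by simp)]

theorem Isom.trans {U V W : Type*} {A : Automaton U} {B : Automaton V} {C : Automaton W}
    (h : Isom A B) (h' : Isom B C) : Isom A C := by
  obtain ⟨e, h1, h2, h3⟩ := h
  obtain ⟨f, g1, g2, g3⟩ := h'
  refine ⟨e.trans f, fun v => ?_, ?_, fun v α => ?_⟩
  · simp [g1, h1]
  · rw [g2, h2, Vertex.map_map]; rfl
  · rw [Equiv.trans_apply, g3, h3, Vertex.map_map]; rfl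

/-- Diagrams of index `k` and size `n` (hence with `n - 2` decision nodes), up to isomorphism. -/
def bddSetoid (n k : ℕ) : Setoid {A : Automaton (Fin (n - 2)) // IsBDD k A} where
  r A B := Isom A.1 B.1
  iseqv := ⟨fun A => Isom.refl A.1, Isom.symm, Isom.trans⟩

/-- `N(n, k)`, the number of diagrams of index `k` and size `n`. -/
noncomputable def numBDD (n k : ℕ) : ℕ := Nat.card (Quotient (bddSetoid n k))

/-! ### Spines -/

/-- Plane binary trees whose nodes carry an index; `nil` is an undefined transition. -/
inductive Spine where
  | nil
  | node (index : ℕ) (low high : Spine)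

/-- The number of nodes. -/
def Spine.size : Spine → ℕ
  | .nil => 0
  | .node _ l h => l.size + h.size + 1

open Classical in
/-- Depth-first search from `q`, low child first, where `seen` lists the decision nodes met
before: the tree of the tree edges found, without the sinks, and the updated list. -/
noncomputable def dfs {V : Type*} {k : ℕ} (A : Automaton V) (hA : IsBDD k A) :
    Vertex V → List V → Spine × List V
  | .sink _, seen => (.nil, seen)
  | .node v, seen =>
    if v ∈ seen then (.nil, seen)
    else
      let low := dfs A hA (A.δ v false) (v :: seen)
      let high := dfs A hA (A.δ v true) low.2
      (.node (A.idx v) low.1 high.1, high.2)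
termination_by q _ => A.index q
decreasing_by
  · exact hA.decreasing v false
  · exact hA.decreasing v true

/-- The spine of a diagram. -/
noncomputable def spine {V : Type*} {k : ℕ} (A : Automaton V) (hA : IsBDD k A) : Spine :=
  (dfs A hA A.root []).1

/-- `𝒯_{m,k}`, the valid spines with `m` nodes for diagrams of index `k`. -/
def validSpines (m k : ℕ) : Set Spine :=
  {T | T.size = m ∧ ∃ (V : Type) (_ : Fintype V) (A : Automaton V) (hA : IsBDD k A),
    spine A hA = T}

/-! ### Pre-computation: counting spines with their weights -/

/-- Sum of profiles of possibly different lengths. -/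
def profileAdd : List ℕ → List ℕ → List ℕ
  | [], w => w
  | v, [] => v
  | a :: v, b :: w => (a + b) :: profileAdd v w

/-- `e⁽ᵏ⁾ = (0, …, 0, 1)`, with `k + 1` components. -/
def unitProfile (k : ℕ) : List ℕ := List.replicate k 0 ++ [1]

/-- `(2, 0, …, 0)`, with `k` components: the pool profile of a root of index `k`. -/
def initialPool (k : ℕ) : List ℕ := 2 :: List.replicate (k - 1) 0

/-- Dictionaries from profiles to cumulated weights. -/
abbrev Dict := List (List ℕ × ℕ)

/-- `d[t] ← d[t] + w`. -/
def Dict.addAt : Dict → List ℕ → ℕ → Dict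
  | [], t, w => [(t, w)]
  | (t', w') :: d, t, w => if t' = t then (t', w' + w) :: d else (t', w') :: Dict.addAt d t w

/-- A table entry for the left or right subtrees of a tree with `m` nodes: their size, pool
profile and level rank of their root, their profile, and their cumulated weight. An entry of
size `0` is an empty subtree; its weight is the number of choices for the half edge. -/
structure SubEntry (m : ℕ) where
  size : ℕ
  size_lt : size < m
  pool : List ℕ
  rank : ℕ
  profile : List ℕ
  weight : ℕ

/-- A way to split a tree with `m` nodes into its root, left subtrees and right subtrees, with
the cumulated weight of the trees obtained. -/
structure Split (m : ℕ) where
  left : SubEntry m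
  right : SubEntry m
  weight : ℕ

/-- The profile of the trees with root index `k` obtained from a split. -/
def Split.profile {m : ℕ} (k : ℕ) (S : Split m) : List ℕ :=
  profileAdd (profileAdd S.left.profile S.right.profile) (unitProfile k)

/-- Collect the weights of a list of splits by profile (the root has index `k`). -/
def collect {m : ℕ} (k : ℕ) (L : List (Split m)) : Dict :=
  L.foldl (fun d S => Dict.addAt d (S.profile k) S.weight) []

/-- The entries for a subtree of size `i` below a root of index `p.length`, where `p` counts by
index the nodes available; a non-empty subtree has a root of index `1 ≤ j < p.length`.
`cnt` is the dictionary for the trees of size `i`, `w` is the number of choices of a half edge. -/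
def subEntries {m : ℕ} (i : ℕ) (hi : i < m) (cnt : List ℕ → ℕ → Dict) (p : List ℕ) (w : ℕ) :
    List (SubEntry m) :=
  if i = 0 then [⟨i, hi, [], 0, [], w⟩]
  else (List.range' 1 (p.length - 1)).flatMap fun j =>
    (cnt (p.take j) (p.getD j 0)).map fun e => ⟨i, hi, p.take j, p.getD j 0, e.1, e.2⟩

/-- The loops of the counting algorithm: all splits of positive weight of a tree with `m` nodes
whose root has index `p.length`, pool profile `p` and level rank `s`. -/
def splits (m : ℕ) (p : List ℕ) (s : ℕ) : List (Split m) :=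
  (List.finRange m).flatMap fun i =>
    (subEntries i.1 i.2 (fun q u => collect q.length (splits i.1 q u)) p p.sum).flatMap fun l =>
      let p' := profileAdd p l.profile
      (subEntries (m - 1 - i.1) (by omega)
        (fun q u => collect q.length (splits (m - 1 - i.1) q u)) p' (p'.sum - 1)).filterMap
        fun r =>
          let w := if m = 1 then l.weight * r.weight - s else l.weight * r.weight
          if 0 < w then some ⟨l, r, w⟩ else none
termination_by m
decreasing_by all_goals omega

/-- `count(m, p, s)`: for every profile, the total weight of the trees with that profile. -/
def count (m : ℕ) (p : List ℕ) (s : ℕ) : Dict := collect p.length (splits m p s)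

/-- The splits with target profile `t`, stored while `count(m, p, s)` is computed. -/
def table (m : ℕ) (p : List ℕ) (s : ℕ) (t : List ℕ) : List (Split m) :=
  (splits m p s).filter fun S => S.profile p.length = t

/-! ### Computations with a count of the operations made -/

/-- A result together with the number of operations spent on it. -/
structure Cost (α : Type*) where
  val : α
  ops : ℕ

instance : Monad Cost where
  pure a := ⟨a, 0⟩
  bind x f := ⟨(f x.val).val, x.ops + (f x.val).ops⟩

/-- One operation, with result `a`. -/
def op {α : Type*} (a : α) : Cost α := ⟨a, 1⟩

/-! ### The unranking algorithm

One operation is charged for every comparison, subtraction and division of sizes, ranks and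
weights, for every node number, and for every choice of the `c`-th element of a list of
candidate children. Reading the pre-computed tables and handling lists of nodes involve no
arithmetic on ranks and weights and are not charged. -/

/-- Sequential search: the item of the list in which rank `r` falls, when every item `a` takes
up `wt a` consecutive ranks, with the remaining rank inside this item. -/
def select {α : Type} (wt : α → ℕ) : List α → ℕ → Cost (Option (α × ℕ))
  | [], _ => pure none
  | a :: L, r => do
    let hit ← op (decide (r < wt a))
    if hit then pure (some (a, r))
    else
      let r' ← op (r - wt a)
      select wt L r'

/-- A spine where every node also carries the number of the choice for its half edges. -/
inductive Plan where
  | nil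
  | node (index choice : ℕ) (low high : Plan)

/-- Unranking of the spines with `m` nodes and profile `t` whose root has pool profile `p` and
level rank `s`, together with the choices for the half edges. -/
def unrankPlan (m : ℕ) (p : List ℕ) (s : ℕ) (t : List ℕ) (r : ℕ) : Cost Plan := do
  let found ← select Split.weight (table m p s t) r
  match found with
  | none => pure .nil
  | some (S, r') => do
    let noLow ← op (decide (S.left.size = 0))
    let noHigh ← op (decide (S.right.size = 0))
    if noLow && noHigh then pure (.node p.length r' .nil .nil)
    else
      let q ← op (r' / S.right.weight)
      let c ← op (r' % S.right.weight)
      if noLow then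
        let high ← unrankPlan S.right.size S.right.pool S.right.rank S.right.profile c
        pure (.node p.length q .nil high)
      else if noHigh then
        let low ← unrankPlan S.left.size S.left.pool S.left.rank S.left.profile q
        pure (.node p.length c low .nil)
      else
        let low ← unrankPlan S.left.size S.left.pool S.left.rank S.left.profile q
        let high ← unrankPlan S.right.size S.right.pool S.right.rank S.right.profile c
        pure (.node p.length 0 low high)
termination_by m
decreasing_by
  · exact S.right.size_lt
  · exact S.left.size_lt
  · exact S.left.size_lt
  · exact S.right.size_lt

/-- A finished node; nodes are numbered from `0` in postorder. -/
structure Record where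
  idx : ℕ
  low : Vertex ℕ
  high : Vertex ℕ

/-- The sinks and the finished nodes of index less than `i`. -/
def candidates (done : List Record) (i : ℕ) : List (Vertex ℕ) :=
  [.sink false, .sink true] ++
    (done.zipIdx.filter fun x => x.1.idx < i).map fun x => .node x.2

/-- The pairs of distinct candidates that are not yet the children of a node of index `i`. -/
def candidatePairs (done : List Record) (i : ℕ) : List (Vertex ℕ × Vertex ℕ) :=
  ((candidates done i).product (candidates done i)).filter fun x =>
    x.1 ≠ x.2 ∧ (i, x.1, x.2) ∉ done.map fun R => (R.idx, R.low, R.high)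

/-- The last finished node. -/
def lastNode (done : List Record) : Vertex ℕ := .node (done.length - 1)

/-- Adds the nodes of a spine to the finished nodes, completing the half edges by the choices
of the plan. -/
def build : Plan → List Record → Cost (List Record)
  | .nil, done => pure done
  | .node i c .nil .nil, done => do
    let x ← op ((candidatePairs done i).getD c (.sink false, .sink true))
    pure (done ++ [⟨i, x.1, x.2⟩])
  | .node i c .nil high, done => do
    let lo ← op ((candidates done i).getD c (.sink false))
    let done' ← build high done
    let hi ← op (lastNode done')
    pure (done' ++ [⟨i, lo, hi⟩])
  | .node i c low .nil, done => do
    let done' ← build low done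
    let lo ← op (lastNode done')
    let hi ← op (((candidates done' i).filter fun q => q ≠ lo).getD c (.sink false))
    pure (done' ++ [⟨i, lo, hi⟩])
  | .node i _ low high, done => do
    let done' ← build low done
    let lo ← op (lastNode done')
    let done'' ← build high done'
    let hi ← op (lastNode done'')
    pure (done'' ++ [⟨i, lo, hi⟩])

/-- Node number `j` among `m` nodes (numbers out of range do not occur in a run). -/
def toVertex (m : ℕ) : Vertex ℕ → Vertex (Fin m)
  | .sink b => .sink b
  | .node j => if h : j < m then .node ⟨j, h⟩ else .sink false

/-- The automaton given by a list of `m` records; its root is the last node. -/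
def toAutomaton (m : ℕ) (L : List Record) : Automaton (Fin m) where
  idx v := ((L[v.1]?).map Record.idx).getD 0
  root := toVertex m (.node (m - 1))
  δ v α := ((L[v.1]?).map fun R => toVertex m (if α then R.high else R.low)).getD (.sink false)

/-- The unranking algorithm: identify the profile of the spine, unrank the spine and the choices
for its half edges, and complete the spine. -/
def unrank (n k r : ℕ) : Cost (Automaton (Fin (n - 2))) := do
  let found ← select Prod.snd (count (n - 2) (initialPool k) 0) r
  match found with
  | none => pure (toAutomaton (n - 2) [])
  | some (e, r') => do
    let plan ← unrankPlan (n - 2) (initialPool k) 0 e.1 r'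
    let done ← build plan []
    pure (toAutomaton (n - 2) done)

/-- The random sampler: draw a rank uniformly in `{0, …, N(n, k) - 1}` and unrank it. -/
noncomputable def sampler (n k : ℕ) (h : 0 < numBDD n k) :
    PMF (Cost (Automaton (Fin (n - 2)))) :=
  (PMF.uniformOfFinset (Finset.range (numBDD n k)) ⟨0, Finset.mem_range.2 h⟩).map
    fun r => unrank n k r

/-! A plan is a spine that carries at each node the number of the choice made for its undefined
transitions. Ranks correspond bijectively to plans, and plans to diagrams up to isomorphism; the
cost bound comes from comparing the searched lists with sets of spines.

Ranks and plans. The number of choices at a node depends only on its pool profile, its level rank,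
the profile of its left subtree and on which subtrees are empty. Hence the weight of a split is the
product of the weights of its two sides (less `s` for a single node), Euclidean division is a
bijection onto pairs, and sequential search glues together splits with disjoint sets of plans:
`Split.bijOn_unrank`, `bijOn_unrankPlan`, `bijOn_unrankAny`.

Plans and diagrams. `build` finishes the nodes in postorder. When a node of index `i` is reached,
the nodes begun but not finished are its ancestors, all of greater index, so its pool and level rank
can be read off the finished nodes. A leaf chooses among the ordered pairs of distinct pool elements
minus the pairs already used at index `i`, which are pairwise distinct and as many as the level
rank. A node with a newly built child cannot repeat an earlier pair. Thus the arithmetic count is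
the true one (`numChoices_eq`) and the result is a diagram (`build_valid`, `isBDD_toAutomaton`). The
inverse is `encode`, a depth-first search that also records the choices (`encode_spec`,
`encode_toAutomaton`); it does not see the names of nodes (`encode_map`).

Cost. Every stored split has positive weight, so some plan realizes it, and the spine of a plan
determines its split. A stored list is therefore no longer than the set of spines with these
parameters (`length_table_le`), and passing to a subtree does not enlarge this set
(`Split.ncard_left_le`, `Split.ncard_right_le`). So each node costs a constant times the number of
spines. -/

/-! ### Spines and plans: size, index, profile, validity -/

/-- The index of the root, `0` for an empty tree. -/
def Spine.index : Spine → ℕ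
  | .nil => 0
  | .node i _ _ => i

/-- The number of nodes of each index. -/
def Spine.profile : Spine → List ℕ
  | .nil => []
  | .node i l h => profileAdd (profileAdd l.profile h.profile) (unitProfile i)

/-- Forget the choices. -/
def Plan.skeleton : Plan → Spine
  | .nil => .nil
  | .node i _ l h => .node i l.skeleton h.skeleton

/-- The number of ways to complete the half edges of a root with pool profile `p`, level rank `s`
and subtrees `l`, `h`. -/
def numChoices (p : List ℕ) (s : ℕ) (l h : Spine) : ℕ :=
  match l, h with
  | .nil, .nil => p.sum * (p.sum - 1) - s
  | .nil, .node .. => p.sum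
  | .node .. , .nil => (profileAdd p l.profile).sum - 1
  | .node .. , .node .. => 1

/-- The non-empty plans which can occur where the pool profile is `p` and the level rank `s`. -/
def Plan.Valid : Plan → List ℕ → ℕ → Prop
  | .nil, _, _ => False
  | .node i c l h, p, s =>
    i = p.length ∧
    (l = .nil ∨ (1 ≤ l.skeleton.index ∧ l.skeleton.index < p.length ∧
      l.Valid (p.take l.skeleton.index) (p.getD l.skeleton.index 0))) ∧
    (h = .nil ∨ (1 ≤ h.skeleton.index ∧ h.skeleton.index < (profileAdd p l.skeleton.profile).length ∧
      h.Valid ((profileAdd p l.skeleton.profile).take h.skeleton.index)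
        ((profileAdd p l.skeleton.profile).getD h.skeleton.index 0))) ∧
    c < numChoices p s l.skeleton h.skeleton

theorem Plan.Valid.index_eq {P : Plan} {p : List ℕ} {s : ℕ} (h : P.Valid p s) :
    P.skeleton.index = p.length := by
  cases P with
  | nil => exact h.elim
  | node i c l r => exact h.1

theorem Plan.Valid.ne_nil {P : Plan} {p : List ℕ} {s : ℕ} (h : P.Valid p s) : P ≠ .nil := by
  rintro rfl; exact h

theorem Plan.skeleton_eq_nil {P : Plan} : P.skeleton = .nil ↔ P = .nil := by
  cases P <;> simp [Plan.skeleton]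

theorem Spine.size_eq_zero {T : Spine} : T.size = 0 ↔ T = .nil := by
  cases T <;> simp [Spine.size]

theorem length_profileAdd (v w : List ℕ) :
    (profileAdd v w).length = max v.length w.length := by
  induction v generalizing w with
  | nil => simp [profileAdd]
  | cons a v ih => cases w <;> simp [profileAdd, ih]

theorem getD_profileAdd (v w : List ℕ) (j : ℕ) :
    (profileAdd v w).getD j 0 = v.getD j 0 + w.getD j 0 := by
  induction v generalizing w j with
  | nil => simp [profileAdd]
  | cons a v ih =>
    cases w with
    | nil => simp [profileAdd]
    | cons b w =>
      cases j with
      | zero => simp [profileAdd]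
      | succ j => simpa [profileAdd] using ih w j

theorem profileAdd_nil (v : List ℕ) : profileAdd v [] = v := by
  cases v <;> rfl

theorem length_unitProfile (k : ℕ) : (unitProfile k).length = k + 1 := by simp [unitProfile]

/-- The root has strictly the largest index. This is what guarantees that adding the profile of a
subtree to the pool of its parent never lengthens that pool. -/
theorem Plan.Valid.length_profile {P : Plan} : ∀ {p : List ℕ} {s : ℕ}, P.Valid p s →
    P.skeleton.profile.length = p.length + 1 := by
  induction P with
  | nil => intro p s h; exact h.elim
  | node i c l r ihl ihr =>
    rintro p s ⟨rfl, hl, hr, -⟩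
    have h1 : l.skeleton.profile.length ≤ p.length := by
      rcases hl with rfl | ⟨_, h2, h3⟩
      · simp [Plan.skeleton, Spine.profile]
      · rw [ihl h3]; simp; omega
    have h2 : r.skeleton.profile.length ≤ p.length := by
      rcases hr with rfl | ⟨_, h2, h3⟩
      · simp [Plan.skeleton, Spine.profile]
      · rw [ihr h3, List.length_take]; rw [length_profileAdd] at h2 ⊢; omega
    simp only [Plan.skeleton, Spine.profile, length_profileAdd, length_unitProfile]
    omega

/-! ### Dictionaries -/

theorem Dict.mem_keys_addAt (d : Dict) (t u : List ℕ) (w : ℕ) :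
    u ∈ (d.addAt t w).map Prod.fst ↔ u = t ∨ u ∈ d.map Prod.fst := by
  induction d with
  | nil => simp [Dict.addAt]
  | cons x d ih =>
    obtain ⟨t', w'⟩ := x
    by_cases h : t' = t
    · simp [Dict.addAt, h]
    · simp only [Dict.addAt, h, if_false, List.map_cons, List.mem_cons, ih]
      tauto

theorem Dict.nodup_keys_addAt (d : Dict) (t : List ℕ) (w : ℕ) (hd : (d.map Prod.fst).Nodup) :
    ((d.addAt t w).map Prod.fst).Nodup := by
  induction d with
  | nil => simp [Dict.addAt]
  | cons x d ih =>
    obtain ⟨t', w'⟩ := x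
    by_cases h : t' = t
    · simpa [Dict.addAt, h] using hd
    · simp only [Dict.addAt, h, if_false, List.map_cons, List.nodup_cons] at hd ⊢
      refine ⟨?_, ih hd.2⟩
      rw [Dict.mem_keys_addAt]
      exact fun h' => h'.elim h hd.1

/-- The weight stored at `t`. -/
def Dict.get (d : Dict) (t : List ℕ) : ℕ := ((d.filter fun x => x.1 = t).map Prod.snd).sum

theorem Dict.get_addAt (d : Dict) (t u : List ℕ) (w : ℕ) :
    (d.addAt t w).get u = d.get u + if t = u then w else 0 := by
  induction d with
  | nil => by_cases h : t = u <;> simp [Dict.addAt, Dict.get, h]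
  | cons x d ih =>
    obtain ⟨t', w'⟩ := x
    unfold Dict.get at ih ⊢
    by_cases h : t' = t
    · subst h
      by_cases hu : t' = u <;> simp [Dict.addAt, hu]
      omega
    · by_cases hu : t' = u
      · subst hu
        have h' : ¬ t = t' := fun e => h e.symm
        rw [if_neg h'] at ih ⊢
        simpa [Dict.addAt, h] using ih
      · simp [Dict.addAt, h, hu, ih]

theorem Dict.get_eq_zero {d : Dict} {t : List ℕ} (h : t ∉ d.map Prod.fst) : d.get t = 0 := by
  have : d.filter (fun x => x.1 = t) = [] := by
    rw [List.filter_eq_nil_iff]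
    intro x hx hx'
    exact h (List.mem_map.2 ⟨x, hx, by simpa using hx'⟩)
  simp [Dict.get, this]

/-- Since keys do not repeat, the sum defining `Dict.get` has at most one term. -/
theorem Dict.mem_iff_get {d : Dict} (hd : (d.map Prod.fst).Nodup) (t : List ℕ) (w : ℕ) :
    (t, w) ∈ d ↔ t ∈ d.map Prod.fst ∧ w = d.get t := by
  induction d with
  | nil => simp
  | cons x d ih =>
    obtain ⟨t', w'⟩ := x
    simp only [List.map_cons, List.nodup_cons] at hd
    have ih := ih hd.2
    by_cases h : t' = t
    · subst h
      have h0 := Dict.get_eq_zero hd.1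
      have h1 : ¬ (t', w) ∈ d := fun h' => hd.1 (List.mem_map.2 ⟨_, h', rfl⟩)
      unfold Dict.get at h0 ⊢
      simp [h1, h0]
    · have h' : ¬ t = t' := fun e => h e.symm
      unfold Dict.get at ih ⊢
      simp only [List.mem_cons, Prod.mk.injEq, h', false_and, false_or, ih, List.map_cons, h,
        decide_false, Bool.false_eq_true, not_false_eq_true, List.filter_cons_of_neg]

/-- The loop invariant of `collect`, stated for an arbitrary starting dictionary so that the
induction on the list goes through. -/
theorem collect_aux {m : ℕ} (k : ℕ) (L : List (Split m)) (d : Dict)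
    (hd : (d.map Prod.fst).Nodup) :
    let c := L.foldl (fun d S => Dict.addAt d (S.profile k) S.weight) d
    (c.map Prod.fst).Nodup ∧
    (∀ t, t ∈ c.map Prod.fst ↔ t ∈ d.map Prod.fst ∨ ∃ S ∈ L, S.profile k = t) ∧
    ∀ t, c.get t = d.get t + ((L.filter fun S => S.profile k = t).map Split.weight).sum := by
  induction L generalizing d with
  | nil => simp [hd]
  | cons S L ih =>
    obtain ⟨h1, h2, h3⟩ := ih (d.addAt (S.profile k) S.weight) (Dict.nodup_keys_addAt _ _ _ hd)
    refine ⟨h1, fun t => ?_, fun t => ?_⟩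
    · rw [List.foldl_cons, h2, Dict.mem_keys_addAt, List.exists_mem_cons_iff, eq_comm (a := t)]
      tauto
    · rw [List.foldl_cons, h3, Dict.get_addAt, List.filter_cons]
      by_cases h : S.profile k = t <;> simp [h, add_assoc]

theorem mem_collect {m k : ℕ} {L : List (Split m)} {t : List ℕ} {w : ℕ} :
    (t, w) ∈ collect k L ↔ (∃ S ∈ L, S.profile k = t) ∧
      w = ((L.filter fun S => S.profile k = t).map Split.weight).sum := by
  obtain ⟨h1, h2, h3⟩ := collect_aux k L [] (by simp)
  unfold collect
  rw [Dict.mem_iff_get h1, h2, h3]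
  simp [Dict.get]

theorem nodup_keys_collect {m : ℕ} (k : ℕ) (L : List (Split m)) :
    ((collect k L).map Prod.fst).Nodup :=
  (collect_aux k L [] (by simp)).1

/-! ### Splits -/

/-- The total weight of the trees with `m` nodes, pool profile `p`, level rank `s` and
profile `t`. -/
def totalWeight (m : ℕ) (p : List ℕ) (s : ℕ) (t : List ℕ) : ℕ :=
  ((table m p s t).map Split.weight).sum

/-- The entry of an empty subtree, or of the subtrees with a given profile; `p` counts the nodes
available, and `w` is the number of choices of a half edge. -/
def SubEntry.IsFor {m : ℕ} (e : SubEntry m) (p : List ℕ) (w : ℕ) : Prop :=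
  (e.size = 0 ∧ e.pool = [] ∧ e.rank = 0 ∧ e.profile = [] ∧ e.weight = w) ∨
  (e.size ≠ 0 ∧ ∃ j, 1 ≤ j ∧ j < p.length ∧ e.pool = p.take j ∧ e.rank = p.getD j 0 ∧
    e.weight = totalWeight e.size e.pool e.rank e.profile ∧ 0 < e.weight)

theorem splits_weight_pos {m : ℕ} {p : List ℕ} {s : ℕ} {S : Split m} (h : S ∈ splits m p s) :
    0 < S.weight := by
  rw [splits] at h
  simp only [List.mem_flatMap, List.mem_filterMap, Option.ite_none_right_eq_some,
    Option.some.injEq] at h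
  obtain ⟨i, -, l, -, r, -, h1, rfl⟩ := h
  exact h1

/-- A key occurs only if some split contributes to it, and splits of weight zero are discarded;
hence the entries are exactly the profiles of positive total weight. -/
theorem mem_count {m : ℕ} {p : List ℕ} {s : ℕ} {t : List ℕ} {w : ℕ} :
    (t, w) ∈ count m p s ↔ w = totalWeight m p s t ∧ 0 < w := by
  rw [count, mem_collect, totalWeight, table]
  constructor
  · rintro ⟨⟨S, hS, hSt⟩, h⟩
    refine ⟨h, h ▸ lt_of_lt_of_le (splits_weight_pos hS) ?_⟩
    exact List.le_sum_of_mem (List.mem_map.2 ⟨S, List.mem_filter.2 ⟨hS, by simpa using hSt⟩, rfl⟩)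
  · rintro ⟨h, h0⟩
    refine ⟨?_, h⟩
    by_contra! hne
    rw [List.filter_eq_nil_iff.2 (by simpa using hne)] at h
    simp at h
    omega

theorem mem_subEntries {m i : ℕ} (hi : i < m) (p : List ℕ) (w : ℕ) (e : SubEntry m) :
    e ∈ subEntries i hi (fun q u => collect q.length (splits i q u)) p w ↔
      e.size = i ∧ e.IsFor p w := by
  obtain ⟨n, hn, q, u, t, v⟩ := e
  unfold subEntries SubEntry.IsFor
  have hc : ∀ q u, collect q.length (splits i q u) = count i q u := fun _ _ => rfl
  by_cases h0 : i = 0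
  · subst h0
    simp only [if_true, List.mem_singleton, SubEntry.mk.injEq]
    constructor
    · rintro ⟨rfl, rfl, rfl, rfl, rfl⟩
      simp
    · rintro ⟨rfl, ⟨-, h⟩ | ⟨h, -⟩⟩
      · exact ⟨rfl, h⟩
      · exact absurd rfl h
  · simp only [h0, if_false, List.mem_flatMap, List.mem_map, hc, Prod.exists, mem_count,
      SubEntry.mk.injEq, List.mem_range'_1]
    constructor
    · rintro ⟨j, ⟨hj, hj'⟩, t', w', ⟨hw, hw'⟩, rfl, rfl, rfl, rfl, rfl⟩
      exact ⟨rfl, Or.inr ⟨h0, j, hj, by omega, rfl, rfl, hw, hw'⟩⟩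
    · rintro ⟨rfl, ⟨h, -⟩ | ⟨h, j, hj, hj', rfl, rfl, hw, hw'⟩⟩
      · exact absurd h h0
      · exact ⟨j, ⟨hj, by omega⟩, t, v, ⟨hw, hw'⟩, rfl, rfl, rfl, rfl, rfl⟩

/-- Entries with different root indices `j` are told apart by the length of the pool `p.take j`;
those with the same `j` by the distinct keys of a dictionary. -/
theorem nodup_subEntries {m i : ℕ} (hi : i < m) (p : List ℕ) (w : ℕ) :
    (subEntries i hi (fun q u => collect q.length (splits i q u)) p w).Nodup := by
  unfold subEntries
  split_ifs with h0
  · simp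
  · rw [List.nodup_flatMap]
    constructor
    · intro j _
      refine List.Nodup.map ?_ (List.Nodup.of_map _ (nodup_keys_collect _ _))
      rintro ⟨a, b⟩ ⟨c, d⟩ h
      simpa using h
    · refine List.Pairwise.imp_of_mem ?_ (List.nodup_range' (s := 1) (n := p.length - 1))
      intro a b ha hb hab x hx hx'
      simp only [List.mem_map] at hx hx'
      obtain ⟨_, _, rfl⟩ := hx
      obtain ⟨_, _, h⟩ := hx'
      simp only [SubEntry.mk.injEq] at h
      have := congrArg List.length h.2.1
      simp only [List.length_take, List.mem_range'_1] at this ha hb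
      omega

/-- A specification free of loops and recursion; membership arguments from here on use it in place
of the definition of `splits`. -/
theorem mem_splits {m : ℕ} {p : List ℕ} {s : ℕ} {S : Split m} :
    S ∈ splits m p s ↔ S.left.size + S.right.size + 1 = m ∧ S.left.IsFor p p.sum ∧
      S.right.IsFor (profileAdd p S.left.profile) ((profileAdd p S.left.profile).sum - 1) ∧
      S.weight = S.left.weight * S.right.weight - (if m = 1 then s else 0) ∧ 0 < S.weight := by
  have hw : ∀ a : ℕ, (if m = 1 then a - s else a) = a - (if m = 1 then s else 0) := by
    intro a; split_ifs <;> rfl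
  rw [splits]
  simp only [List.mem_flatMap, List.mem_filterMap, Option.ite_none_right_eq_some,
    Option.some.injEq, mem_subEntries, hw]
  obtain ⟨l, r, w⟩ := S
  constructor
  · rintro ⟨i, -, l, ⟨h1, h2⟩, r, ⟨h3, h4⟩, h5, h6⟩
    simp only [Split.mk.injEq] at h6
    obtain ⟨rfl, rfl, rfl⟩ := h6
    have := i.2
    exact ⟨by simp only []; omega, h2, h4, rfl, h5⟩
  · rintro ⟨h1, h2, h3, h4, h5⟩
    simp only at h1 h2 h3 h4 h5
    exact ⟨⟨l.size, l.size_lt⟩, List.mem_finRange _, l, ⟨rfl, h2⟩, r, ⟨by simp only []; omega, h3⟩,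
      h4 ▸ h5, by simp [h4]⟩

theorem nodup_splits (m : ℕ) (p : List ℕ) (s : ℕ) : (splits m p s).Nodup := by
  rw [splits, List.nodup_flatMap]
  constructor
  · intro i _
    rw [List.nodup_flatMap]
    constructor
    · intro l _
      refine List.Nodup.filterMap ?_ (nodup_subEntries _ _ _)
      intro r r' S h h'
      simp only [Option.mem_def, Option.ite_none_right_eq_some, Option.some.injEq] at h h'
      have := h.2.trans h'.2.symm
      simp only [Split.mk.injEq] at this
      exact this.2.1
    · refine List.Pairwise.imp ?_ (nodup_subEntries _ _ _)
      intro a b hab S h h'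
      simp only [List.mem_filterMap, Option.ite_none_right_eq_some, Option.some.injEq] at h h'
      obtain ⟨_, _, _, rfl⟩ := h
      obtain ⟨_, _, _, h⟩ := h'
      simp only [Split.mk.injEq] at h
      exact hab h.1.symm
  · refine List.Pairwise.imp ?_ (List.nodup_finRange m)
    intro a b hab S h h'
    simp only [List.mem_flatMap, List.mem_filterMap, Option.ite_none_right_eq_some,
      Option.some.injEq, mem_subEntries] at h h'
    obtain ⟨_, h1, _, _, _, rfl⟩ := h
    obtain ⟨_, h2, _, _, _, h⟩ := h'
    simp only [Split.mk.injEq] at h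
    obtain ⟨rfl, -, -⟩ := h
    exact hab (Fin.ext (h1.1.symm.trans h2.1))

/-! ### Sequential search -/

@[simp] theorem Cost.val_pure {α : Type*} (a : α) : (pure a : Cost α).val = a := rfl

@[simp] theorem Cost.ops_pure {α : Type*} (a : α) : (pure a : Cost α).ops = 0 := rfl

@[simp] theorem Cost.val_bind {α β : Type} (x : Cost α) (f : α → Cost β) :
    (x >>= f).val = (f x.val).val := rfl

@[simp] theorem Cost.ops_bind {α β : Type} (x : Cost α) (f : α → Cost β) :
    (x >>= f).ops = x.ops + (f x.val).ops := rfl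

@[simp] theorem val_op {α : Type*} (a : α) : (op a).val = a := rfl

@[simp] theorem ops_op {α : Type*} (a : α) : (op a).ops = 1 := rfl

theorem select_cons_val {α : Type} (wt : α → ℕ) (a : α) (L : List α) (r : ℕ) :
    (select wt (a :: L) r).val =
      if r < wt a then some (a, r) else (select wt L (r - wt a)).val := by
  by_cases h : r < wt a <;> simp [select, h]

theorem select_ops {α : Type} (wt : α → ℕ) (L : List α) (r : ℕ) :
    (select wt L r).ops ≤ 2 * L.length := by
  induction L generalizing r with
  | nil => simp [select]
  | cons a L ih =>
    have := ih (r - wt a)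
    by_cases h : r < wt a <;> simp [select, h] <;> omega

theorem select_val {α : Type} (wt : α → ℕ) (L : List α) (r : ℕ) (hr : r < (L.map wt).sum) :
    ∃ a ∈ L, ∃ r' < wt a, (select wt L r).val = some (a, r') := by
  induction L generalizing r with
  | nil => simp at hr
  | cons a L ih =>
    rw [select_cons_val]
    split_ifs with h
    · exact ⟨a, by simp, r, h, rfl⟩
    · simp only [List.map_cons, List.sum_cons] at hr
      obtain ⟨b, hb, h'⟩ := ih (r - wt a) (by omega)
      exact ⟨b, by simp [hb], h'⟩

/-- The items cut the ranks into consecutive intervals, one per item, and the sets `B a` are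
disjoint, so bijections on the pieces glue. The function `g` stands for the continuation of the
algorithm, including its irrelevant value at `none`. -/
theorem bijOn_select {α β : Type} (wt : α → ℕ) (f : α → ℕ → β) (B : α → Set β)
    (g : Option (α × ℕ) → β) (hg : ∀ a r, g (some (a, r)) = f a r) (L : List α)
    (hf : ∀ a ∈ L, Set.BijOn (f a) (Set.Iio (wt a)) (B a))
    (hL : L.Pairwise fun a b => Disjoint (B a) (B b)) :
    Set.BijOn (fun r => g (select wt L r).val) (Set.Iio (L.map wt).sum)
      {x | ∃ a ∈ L, x ∈ B a} := by
  induction L with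
  | nil =>
    refine ⟨fun r hr => ?_, fun r hr => ?_, fun x hx => ?_⟩
    · simp at hr
    · simp at hr
    · simp at hx
  | cons a L ih =>
    obtain ⟨ih1, ih2, ih3⟩ := ih (fun b hb => hf b (by simp [hb])) (List.Pairwise.of_cons hL)
    obtain ⟨h1, h2, h3⟩ := hf a (by simp)
    have hd : ∀ {b}, b ∈ L → Disjoint (B a) (B b) := fun hb => List.rel_of_pairwise_cons hL hb
    have key : ∀ r, g (select wt (a :: L) r).val =
        if r < wt a then f a r else g (select wt L (r - wt a)).val := by
      intro r
      rw [select_cons_val]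
      split_ifs <;> simp [hg]
    simp only [key]
    have hsub : ∀ r, r < ((a :: L).map wt).sum → ¬ r < wt a → r - wt a < (L.map wt).sum := by
      intro r hr hr'
      simp only [List.map_cons, List.sum_cons] at hr
      omega
    have hsep : ∀ r r', r < wt a → r' < (L.map wt).sum → f a r ≠ g (select wt L r').val := by
      intro r r' hr hr' he
      obtain ⟨b, hb, hb'⟩ := ih1 hr'
      exact Set.disjoint_left.1 (hd hb) (h1 hr) (he ▸ hb')
    refine ⟨fun r hr => ?_, fun r hr r' hr' he => ?_, fun x hx => ?_⟩
    · dsimp only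
      split_ifs with h
      · exact ⟨a, by simp, h1 h⟩
      · obtain ⟨b, hb, hb'⟩ := ih1 (hsub r hr h)
        exact ⟨b, by simp [hb], hb'⟩
    · dsimp only at he
      split_ifs at he with h h' h'
      · exact h2 h h' he
      · exact absurd he (hsep _ _ h (hsub _ hr' h'))
      · exact absurd he.symm (hsep _ _ h' (hsub _ hr h))
      · have := ih2 (hsub _ hr h) (hsub _ hr' h') he
        omega
    · obtain ⟨b, hb, hb'⟩ := hx
      rcases List.mem_cons.1 hb with rfl | hb
      · obtain ⟨r, hr, rfl⟩ := h3 hb'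
        have hr : r < wt b := hr
        refine ⟨r, ?_, by simp [hr]⟩
        simp only [List.map_cons, List.sum_cons, Set.mem_Iio]
        omega
      · obtain ⟨r, hr, rfl⟩ := ih3 ⟨b, hb, hb'⟩
        have hr : r < (L.map wt).sum := hr
        refine ⟨wt a + r, ?_, by simp⟩
        simp only [List.map_cons, List.sum_cons, Set.mem_Iio]
        omega

/-- Stated for an arbitrary `F` because either component may be the rank of a subtree or the number
of a choice. -/
theorem bijOn_divMod {β : Type} {a b : ℕ} {F : ℕ → ℕ → β} {X : Set β}
    (h : Set.BijOn (fun x : ℕ × ℕ => F x.1 x.2) (Set.Iio a ×ˢ Set.Iio b) X) :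
    Set.BijOn (fun r => F (r / b) (r % b)) (Set.Iio (a * b)) X := by
  refine h.comp (g := fun x : ℕ × ℕ => F x.1 x.2) (f := fun r => (r / b, r % b)) ?_
  refine ⟨fun r hr => ?_, fun r _ r' _ he => ?_, fun x hx => ?_⟩
  · have hr : r < a * b := hr
    have hb : 0 < b := by
      rcases Nat.eq_zero_or_pos b with rfl | hb
      · simp at hr
      · exact hb
    exact ⟨(Nat.div_lt_iff_lt_mul hb).2 hr, Nat.mod_lt _ hb⟩
  · simp only [Prod.mk.injEq] at he
    rw [← Nat.div_add_mod r b, ← Nat.div_add_mod r' b, he.1, he.2]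
  · obtain ⟨x, y⟩ := x
    have hx1 : x < a := hx.1
    have hy1 : y < b := hx.2
    refine ⟨x * b + y, ?_, ?_⟩
    · have : (x + 1) * b ≤ a * b := Nat.mul_le_mul_right b hx1
      simp only [Set.mem_Iio]
      rw [add_mul] at this
      omega
    · have hb : 0 < b := by omega
      simp only [Prod.mk.injEq]
      rw [mul_comm, Nat.mul_add_div hb, Nat.div_eq_of_lt hy1, Nat.mul_add_mod, Nat.mod_eq_of_lt hy1]
      simp

/-! ### Unranking of plans -/

/-- The plans that `unrankPlan` produces. -/
def validPlans (m : ℕ) (p : List ℕ) (s : ℕ) (t : List ℕ) : Set Plan :=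
  {P | P.Valid p s ∧ P.skeleton.size = m ∧ P.skeleton.profile = t}

/-- The subtrees described by a table entry. -/
def SubEntry.plans {m : ℕ} (e : SubEntry m) : Set Plan :=
  if e.size = 0 then {.nil} else validPlans e.size e.pool e.rank e.profile

/-- The plans described by a split. -/
def Split.plans {m : ℕ} (p : List ℕ) (s : ℕ) (S : Split m) : Set Plan :=
  {P | ∃ c l h, P = .node p.length c l h ∧ l ∈ S.left.plans ∧ h ∈ S.right.plans ∧
    c < numChoices p s l.skeleton h.skeleton}

/-- Unranking of a plan for a given entry. -/
def SubEntry.unrank {m : ℕ} (e : SubEntry m) (r : ℕ) : Cost Plan :=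
  unrankPlan e.size e.pool e.rank e.profile r

/-- Unranking of a plan for a given split. -/
def Split.unrank {m : ℕ} (i : ℕ) (S : Split m) (r : ℕ) : Cost Plan := do
  let noLow ← op (decide (S.left.size = 0))
  let noHigh ← op (decide (S.right.size = 0))
  if noLow && noHigh then pure (.node i r .nil .nil)
  else
    let q ← op (r / S.right.weight)
    let c ← op (r % S.right.weight)
    if noLow then
      let high ← S.right.unrank c
      pure (.node i q .nil high)
    else if noHigh then
      let low ← S.left.unrank q
      pure (.node i c low .nil)
    else
      let low ← S.left.unrank q
      let high ← S.right.unrank c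
      pure (.node i 0 low high)

theorem unrankPlan_eq (m : ℕ) (p : List ℕ) (s : ℕ) (t : List ℕ) (r : ℕ) :
    unrankPlan m p s t r = (do
      let found ← select Split.weight (table m p s t) r
      match found with
      | none => pure .nil
      | some (S, r') => S.unrank p.length r') := by
  rw [unrankPlan]
  rfl

theorem SubEntry.plans_nil_of_size {m : ℕ} {e : SubEntry m} (h : e.size = 0) :
    e.plans = {.nil} := by simp [SubEntry.plans, h]

theorem SubEntry.plans_of_size {m : ℕ} {e : SubEntry m} (h : e.size ≠ 0) :
    e.plans = validPlans e.size e.pool e.rank e.profile := by simp [SubEntry.plans, h]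

theorem SubEntry.IsFor.size_profile {m : ℕ} {e : SubEntry m} {p : List ℕ} {w : ℕ}
    (h : e.IsFor p w) {Q : Plan} (hQ : Q ∈ e.plans) :
    Q.skeleton.size = e.size ∧ Q.skeleton.profile = e.profile := by
  rcases h with ⟨h0, -, -, hp, -⟩ | ⟨h0, -⟩
  · rw [SubEntry.plans_nil_of_size h0] at hQ
    rw [Set.mem_singleton_iff.1 hQ, h0, hp]
    exact ⟨rfl, rfl⟩
  · rw [SubEntry.plans_of_size h0] at hQ
    exact hQ.2

/-- Size, profile and root index are visible on the spine; pool, rank and weight follow from them.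
Only the spines need to agree, not the choices: bijectivity needs the weaker form, the cost bound
needs this one. -/
theorem SubEntry.IsFor.eq_of_plans {m : ℕ} {e e' : SubEntry m} {p : List ℕ} {w : ℕ}
    (h : e.IsFor p w) (h' : e'.IsFor p w) {Q Q' : Plan} (hQ : Q ∈ e.plans) (hQ' : Q' ∈ e'.plans)
    (hQQ : Q.skeleton = Q'.skeleton) : e = e' := by
  obtain ⟨h1, h2⟩ := h.size_profile hQ
  obtain ⟨h1', h2'⟩ := h'.size_profile hQ'
  rw [← hQQ] at h1' h2'
  obtain ⟨n, hn, q, u, t, v⟩ := e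
  obtain ⟨n', hn', q', u', t', v'⟩ := e'
  simp only at h1 h2 h1' h2'
  subst h1; subst h2; subst h1'; subst h2'
  rcases h with ⟨h0, a1, a2, a3, a4⟩ | ⟨h0, j, _, a0, a1, a2, a3, _⟩ <;>
  rcases h' with ⟨h0', b1, b2, b3, b4⟩ | ⟨h0', j', _, b0, b1, b2, b3, _⟩
  · simp only at a1 a2 a3 a4 b1 b2 b3 b4
    subst a1; subst a2; subst a4; subst b1; subst b2; subst b4
    rfl
  · exact absurd h0 h0'
  · exact absurd h0' h0
  · rw [SubEntry.plans_of_size h0] at hQ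
    rw [SubEntry.plans_of_size h0'] at hQ'
    have e1 := hQ.1.index_eq
    have e2 := hQ'.1.index_eq
    simp only at a1 a2 a3 b1 b2 b3 e1 e2
    subst a1; subst a2; subst b1; subst b2
    simp only [List.length_take] at e1 e2
    have hj : j = j' := by rw [← hQQ] at e2; omega
    subst hj
    subst a3; subst b3
    rfl

theorem Split.eq_of_plans {m : ℕ} {p : List ℕ} {s : ℕ} {S S' : Split m} (h : S ∈ splits m p s)
    (h' : S' ∈ splits m p s) {P P' : Plan} (hP : P ∈ S.plans p s) (hP' : P' ∈ S'.plans p s)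
    (hPP : P.skeleton = P'.skeleton) : S = S' := by
  obtain ⟨-, h1, h2, h3, -⟩ := mem_splits.1 h
  obtain ⟨-, h1', h2', h3', -⟩ := mem_splits.1 h'
  obtain ⟨c, l, r, rfl, hl, hr, -⟩ := hP
  obtain ⟨c', l', r', rfl, hl', hr', -⟩ := hP'
  simp only [Plan.skeleton, Spine.node.injEq, true_and] at hPP
  have e1 := h1.eq_of_plans h1' hl hl' hPP.1
  have e2 := h2.eq_of_plans (e1 ▸ h2') hr hr' hPP.2
  cases S; cases S'
  simp only at *
  subst e1; subst e2
  rw [h3, h3']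

theorem Split.profile_of_plans {m : ℕ} {p : List ℕ} {s : ℕ} {S : Split m} (h : S ∈ splits m p s)
    {P : Plan} (hP : P ∈ S.plans p s) :
    P.Valid p s ∧ P.skeleton.size = m ∧ P.skeleton.profile = S.profile p.length := by
  obtain ⟨h0, h1, h2, -, -⟩ := mem_splits.1 h
  obtain ⟨c, l, r, rfl, hl, hr, hc⟩ := hP
  obtain ⟨sl, tl⟩ := h1.size_profile hl
  obtain ⟨sr, tr⟩ := h2.size_profile hr
  have valid : ∀ {p : List ℕ} {w : ℕ} {e : SubEntry m} {Q : Plan}, e.IsFor p w → Q ∈ e.plans →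
      Q = .nil ∨ (1 ≤ Q.skeleton.index ∧ Q.skeleton.index < p.length ∧
      Q.Valid (p.take Q.skeleton.index) (p.getD Q.skeleton.index 0)) := by
    intro p w e Q he hQ
    rcases he with ⟨he, -⟩ | ⟨he, j, hj, hj', e1, e2, -⟩
    · rw [SubEntry.plans_nil_of_size he] at hQ
      exact Or.inl hQ
    · rw [SubEntry.plans_of_size he] at hQ
      have := hQ.1
      have hi := this.index_eq
      rw [e1, List.length_take] at hi
      have hi : Q.skeleton.index = j := by omega
      rw [e1, e2] at this
      rw [hi]
      exact Or.inr ⟨hj, hj', this⟩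
  refine ⟨⟨rfl, valid h1 hl, ?_, hc⟩, ?_, ?_⟩
  · rw [tl]; exact valid h2 hr
  · simp only [Plan.skeleton, Spine.size, sl, sr, h0]
  · simp only [Plan.skeleton, Spine.profile, Split.profile, tl, tr]

/-- The entry for a given subtree. -/
theorem exists_subEntry {m : ℕ} {p : List ℕ} {w : ℕ} {Q : Plan} (hm : Q.skeleton.size < m)
    (hQ : Q = .nil ∨ (1 ≤ Q.skeleton.index ∧ Q.skeleton.index < p.length ∧
      Q.Valid (p.take Q.skeleton.index) (p.getD Q.skeleton.index 0)))
    (ih : ∀ p s t, Set.BijOn (fun r => (unrankPlan Q.skeleton.size p s t r).val)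
      (Set.Iio (totalWeight Q.skeleton.size p s t)) (validPlans Q.skeleton.size p s t)) :
    ∃ e : SubEntry m, e.IsFor p w ∧ Q ∈ e.plans ∧
      (Q ≠ .nil → 0 < e.weight) := by
  by_cases h : Q = .nil
  · subst h
    exact ⟨⟨0, hm, [], 0, [], w⟩, Or.inl ⟨rfl, rfl, rfl, rfl, rfl⟩, by simp [SubEntry.plans],
      fun h => absurd rfl h⟩
  · obtain ⟨h1, h2, h3⟩ := hQ.resolve_left h
    have hs : Q.skeleton.size ≠ 0 := fun h' =>
      h (Plan.skeleton_eq_nil.1 (Spine.size_eq_zero.1 h'))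
    have hQ' : Q ∈ validPlans Q.skeleton.size (p.take Q.skeleton.index)
      (p.getD Q.skeleton.index 0) Q.skeleton.profile := ⟨h3, rfl, rfl⟩
    obtain ⟨r, hr, -⟩ := (ih _ _ _).surjOn hQ'
    have hr : r < _ := hr
    refine ⟨⟨Q.skeleton.size, hm, p.take Q.skeleton.index, p.getD Q.skeleton.index 0,
      Q.skeleton.profile, totalWeight Q.skeleton.size (p.take Q.skeleton.index)
      (p.getD Q.skeleton.index 0) Q.skeleton.profile⟩, ?_, ?_, ?_⟩
    · exact Or.inr ⟨hs, _, h1, h2, rfl, rfl, rfl, by simp only []; omega⟩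
    · rw [SubEntry.plans_of_size (by exact hs)]; exact hQ'
    · intro _; simp only []; omega

/-- The weight of an empty side is a number of choices, not of subtrees, so it is moved into
`numChoices` and replaced by `1`. The equation shows that the number of choices is the same for all
pairs of subtrees of a split. -/
theorem Split.weight_eq {m : ℕ} {p : List ℕ} {s : ℕ} {l r : SubEntry m}
    (h0 : l.size + r.size + 1 = m) (h1 : l.IsFor p p.sum)
    (h2 : r.IsFor (profileAdd p l.profile) ((profileAdd p l.profile).sum - 1)) {P Q : Plan}
    (hP : P ∈ l.plans) (hQ : Q ∈ r.plans) :
    l.weight * r.weight - (if m = 1 then s else 0) =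
      (if l.size = 0 then 1 else l.weight) * (if r.size = 0 then 1 else r.weight) *
        numChoices p s P.skeleton Q.skeleton := by
  by_cases hl : l.size = 0 <;> by_cases hr : r.size = 0
  · obtain ⟨-, -, -, b3, b⟩ := h1.resolve_right (fun h => h.1 hl)
    obtain ⟨-, -, -, -, b'⟩ := h2.resolve_right (fun h => h.1 hr)
    rw [SubEntry.plans_nil_of_size hl, Set.mem_singleton_iff] at hP
    rw [SubEntry.plans_nil_of_size hr, Set.mem_singleton_iff] at hQ
    have : m = 1 := by omega
    subst hP; subst hQ
    simp [hl, hr, b, b', b3, this, Plan.skeleton, numChoices, profileAdd_nil]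
  · obtain ⟨-, -, -, b3, b⟩ := h1.resolve_right (fun h => h.1 hl)
    rw [SubEntry.plans_nil_of_size hl, Set.mem_singleton_iff] at hP
    rw [SubEntry.plans_of_size hr] at hQ
    have : m ≠ 1 := by omega
    subst hP
    cases Q with
    | nil => exact hQ.1.elim
    | node => simp [hl, hr, b, this, Plan.skeleton, numChoices, mul_comm]
  · obtain ⟨-, -, -, -, b'⟩ := h2.resolve_right (fun h => h.1 hr)
    rw [SubEntry.plans_nil_of_size hr, Set.mem_singleton_iff] at hQ
    rw [SubEntry.plans_of_size hl] at hP
    have : m ≠ 1 := by omega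
    subst hQ
    cases P with
    | nil => exact hP.1.elim
    | node => simp [hl, hr, b', this, Plan.skeleton, numChoices, ← hP.2.2]
  · rw [SubEntry.plans_of_size hl] at hP
    rw [SubEntry.plans_of_size hr] at hQ
    have : m ≠ 1 := by omega
    cases P with
    | nil => exact hP.1.elim
    | node =>
      cases Q with
      | nil => exact hQ.1.elim
      | node => simp [hl, hr, this, Plan.skeleton, numChoices]

/-- Where a side is empty, its part of the divided rank is the choice: the quotient for a missing
low child, the remainder for a missing high child. Without subtrees the whole rank is the choice;
with two subtrees the choice is forced to be `0`. -/
theorem Split.bijOn_unrank {m : ℕ} {p : List ℕ} {s : ℕ} {S : Split m} (hS : S ∈ splits m p s)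
    (ih : ∀ n < m, ∀ p s t, Set.BijOn (fun r => (unrankPlan n p s t r).val)
      (Set.Iio (totalWeight n p s t)) (validPlans n p s t)) :
    Set.BijOn (fun r => (S.unrank p.length r).val) (Set.Iio S.weight) (S.plans p s) := by
  obtain ⟨h0, h1, h2, h3, h4⟩ := mem_splits.1 hS
  obtain ⟨l, r, w⟩ := S
  simp only at h0 h1 h2 h3 h4
  have hw := fun P Q hP hQ => Split.weight_eq (s := s) h0 h1 h2 (P := P) (Q := Q) hP hQ
  rw [← h3] at hw
  have ihe : ∀ {e : SubEntry m} {p w}, e.IsFor p w → e.size ≠ 0 →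
      Set.BijOn (fun r => (e.unrank r).val) (Set.Iio e.weight) e.plans := by
    intro e p w he h
    obtain ⟨j, -, -, -, -, hw, -⟩ := (he.resolve_left (fun h' => h h'.1)).2
    rw [SubEntry.plans_of_size h, hw]
    exact ih _ e.size_lt _ _ _
  by_cases hl : l.size = 0 <;> by_cases hr : r.size = 0
  · have pl := SubEntry.plans_nil_of_size hl
    have pr := SubEntry.plans_nil_of_size hr
    have hw := hw .nil .nil (by simp [pl]) (by simp [pr])
    simp only [hl, hr, if_true, one_mul] at hw
    simp only [Split.unrank, Cost.val_bind, val_op, hl, hr, decide_true, Bool.and_self, if_true,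
      Cost.val_pure, Split.plans, pl, pr, Set.mem_singleton_iff]
    refine ⟨fun c hc => ⟨c, .nil, .nil, rfl, rfl, rfl, hw ▸ hc⟩, fun c _ c' _ he => ?_, ?_⟩
    · simpa using he
    · rintro _ ⟨c, _, _, rfl, rfl, rfl, hc⟩
      exact ⟨c, by simpa [hw] using hc, rfl⟩
  · have pl := SubEntry.plans_nil_of_size hl
    obtain ⟨i1, i2, i3⟩ := ihe h2 hr
    have lw : l.weight = p.sum := (h1.resolve_right (fun h => h.1 hl)).2.2.2.2
    have hc : ∀ h ∈ r.plans, numChoices p s Plan.nil.skeleton h.skeleton = l.weight := by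
      intro h hh
      rw [SubEntry.plans_of_size hr] at hh
      cases h with
      | nil => exact hh.1.elim
      | node => simp [Plan.skeleton, numChoices, lw]
    have hm : m ≠ 1 := by omega
    simp only [hm, if_false, Nat.sub_zero] at h3
    subst h3
    simp only [Split.unrank, Cost.val_bind, val_op, hl, hr, decide_true, decide_false,
      Bool.and_false, Bool.false_eq_true, if_false, if_true, Cost.val_pure, Split.plans, pl,
      Set.mem_singleton_iff]
    refine bijOn_divMod (F := fun q c => Plan.node p.length q .nil (r.unrank c).val) ?_
    refine ⟨fun x hx => ?_, fun x hx y hy he => ?_, ?_⟩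
    · exact ⟨x.1, .nil, _, rfl, rfl, i1 hx.2, by rw [hc _ (i1 hx.2)]; exact hx.1⟩
    · simp only [Plan.node.injEq, true_and] at he
      exact Prod.ext he.1 (i2 hx.2 hy.2 he.2)
    · rintro _ ⟨c, _, h, rfl, rfl, hh, hc'⟩
      rw [hc _ hh] at hc'
      obtain ⟨d, hd, rfl⟩ := i3 hh
      exact ⟨(c, d), ⟨hc', hd⟩, rfl⟩
  · have pr := SubEntry.plans_nil_of_size hr
    obtain ⟨i1, i2, i3⟩ := ihe h1 hl
    have rw' : r.weight = (profileAdd p l.profile).sum - 1 :=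
      (h2.resolve_right (fun h => h.1 hr)).2.2.2.2
    have hc : ∀ h ∈ l.plans, numChoices p s h.skeleton Plan.nil.skeleton = r.weight := by
      intro h hh
      rw [SubEntry.plans_of_size hl] at hh
      cases h with
      | nil => exact hh.1.elim
      | node => simp [Plan.skeleton, numChoices, rw', ← hh.2.2]
    have hm : m ≠ 1 := by omega
    simp only [hm, if_false, Nat.sub_zero] at h3
    subst h3
    simp only [Split.unrank, Cost.val_bind, val_op, hl, hr, decide_true, decide_false,
      Bool.false_and, Bool.false_eq_true, if_false, if_true, Cost.val_pure, Split.plans, pr,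
      Set.mem_singleton_iff]
    refine bijOn_divMod (F := fun q c => Plan.node p.length c (l.unrank q).val .nil) ?_
    refine ⟨fun x hx => ?_, fun x hx y hy he => ?_, ?_⟩
    · exact ⟨x.2, _, .nil, rfl, i1 hx.1, rfl, by rw [hc _ (i1 hx.1)]; exact hx.2⟩
    · simp only [Plan.node.injEq, true_and, and_true] at he
      exact Prod.ext (i2 hx.1 hy.1 he.2) he.1
    · rintro _ ⟨c, h, _, rfl, hh, rfl, hc'⟩
      rw [hc _ hh] at hc'
      obtain ⟨d, hd, rfl⟩ := i3 hh
      exact ⟨(d, c), ⟨hd, hc'⟩, rfl⟩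
  · obtain ⟨i1, i2, i3⟩ := ihe h1 hl
    obtain ⟨j1, j2, j3⟩ := ihe h2 hr
    have hc : ∀ h ∈ l.plans, ∀ h' ∈ r.plans, numChoices p s h.skeleton h'.skeleton = 1 := by
      intro h hh h' hh'
      rw [SubEntry.plans_of_size hl] at hh
      rw [SubEntry.plans_of_size hr] at hh'
      cases h with
      | nil => exact hh.1.elim
      | node =>
        cases h' with
        | nil => exact hh'.1.elim
        | node => simp [Plan.skeleton, numChoices]
    have hm : m ≠ 1 := by omega
    simp only [hm, if_false, Nat.sub_zero] at h3
    subst h3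
    simp only [Split.unrank, Cost.val_bind, val_op, hl, hr, decide_false,
      Bool.false_and, Bool.false_eq_true, if_false, Cost.val_pure, Split.plans]
    refine bijOn_divMod (F := fun q c => Plan.node p.length 0 (l.unrank q).val (r.unrank c).val) ?_
    refine ⟨fun x hx => ?_, fun x hx y hy he => ?_, ?_⟩
    · exact ⟨0, _, _, rfl, i1 hx.1, j1 hx.2, by rw [hc _ (i1 hx.1) _ (j1 hx.2)]; exact one_pos⟩
    · simp only [Plan.node.injEq, true_and] at he
      exact Prod.ext (i2 hx.1 hy.1 he.1) (j2 hx.2 hy.2 he.2)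
    · rintro _ ⟨c, h, h', rfl, hh, hh', hc'⟩
      rw [hc _ hh _ hh'] at hc'
      obtain ⟨d, hd, rfl⟩ := i3 hh
      obtain ⟨d', hd', rfl⟩ := j3 hh'
      obtain rfl : c = 0 := by omega
      exact ⟨(d, d'), ⟨hd, hd'⟩, rfl⟩

/-- Only splits of positive weight are stored, so a valid plan must be shown to come from such a
split. The induction hypothesis does this: a valid subtree lies in the image of the ranks below the
weight of its entry, which is thus not zero. -/
theorem mem_validPlans_iff {m : ℕ} {p : List ℕ} {s : ℕ} {t : List ℕ} {P : Plan}
    (ih : ∀ n < m, ∀ p s t, Set.BijOn (fun r => (unrankPlan n p s t r).val)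
      (Set.Iio (totalWeight n p s t)) (validPlans n p s t)) :
    P ∈ validPlans m p s t ↔ ∃ S ∈ table m p s t, P ∈ S.plans p s := by
  simp only [table, List.mem_filter, decide_eq_true_eq]
  constructor
  · rintro ⟨hv, hm, ht⟩
    cases P with
    | nil => exact hv.elim
    | node i c l h =>
      obtain ⟨rfl, hl, hh, hc⟩ := hv
      simp only [Plan.skeleton, Spine.size] at hm
      obtain ⟨e, e1, e2, e3⟩ := exists_subEntry (m := m) (w := p.sum) (by omega) hl
        (ih _ (by omega))
      obtain ⟨-, e4⟩ := e1.size_profile e2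
      rw [e4] at hh
      obtain ⟨f, f1, f2, f3⟩ := exists_subEntry (m := m)
        (w := (profileAdd p e.profile).sum - 1) (by omega) hh (ih _ (by omega))
      obtain ⟨se, pe⟩ := e1.size_profile e2
      obtain ⟨sf, pf⟩ := f1.size_profile f2
      have hw := Split.weight_eq (s := s) (by omega : e.size + f.size + 1 = m) e1 f1 e2 f2
      have hpos : 0 < e.weight * f.weight - (if m = 1 then s else 0) := by
        rw [hw]
        have he : 0 < if e.size = 0 then 1 else e.weight := by
          split_ifs with h'
          · exact one_pos
          · exact e3 (by rintro rfl; exact h' se.symm)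
        have hf : 0 < if f.size = 0 then 1 else f.weight := by
          split_ifs with h'
          · exact one_pos
          · exact f3 (by rintro rfl; exact h' sf.symm)
        have : 0 < numChoices p s l.skeleton h.skeleton := by omega
        positivity
      have hS : (⟨e, f, e.weight * f.weight - (if m = 1 then s else 0)⟩ : Split m) ∈
          splits m p s :=
        mem_splits.2 ⟨by simp only []; omega, e1, f1, rfl, hpos⟩
      have hP : Plan.node p.length c l h ∈ Split.plans p s
          (⟨e, f, e.weight * f.weight - (if m = 1 then s else 0)⟩ : Split m) :=
        ⟨c, l, h, rfl, e2, f2, hc⟩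
      exact ⟨_, ⟨hS, (Split.profile_of_plans hS hP).2.2.symm.trans ht⟩, hP⟩
  · rintro ⟨S, ⟨hS, rfl⟩, hP⟩
    exact Split.profile_of_plans hS hP

theorem nodup_table (m : ℕ) (p : List ℕ) (s : ℕ) (t : List ℕ) : (table m p s t).Nodup :=
  (nodup_splits m p s).filter _

/-- Unranking is a bijection between the ranks and the plans with the given parameters. -/
theorem bijOn_unrankPlan (m : ℕ) : ∀ (p : List ℕ) (s : ℕ) (t : List ℕ),
    Set.BijOn (fun r => (unrankPlan m p s t r).val) (Set.Iio (totalWeight m p s t))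
      (validPlans m p s t) := by
  induction m using Nat.strong_induction_on with
  | _ m ih =>
    intro p s t
    have e : validPlans m p s t = {P | ∃ S ∈ table m p s t, P ∈ S.plans p s} :=
      Set.ext fun P => mem_validPlans_iff ih
    rw [e]
    have hT : ∀ S ∈ table m p s t, S ∈ splits m p s := fun S hS => (List.mem_filter.1 hS).1
    have := bijOn_select Split.weight (fun S r => (S.unrank p.length r).val) (Split.plans p s)
      (fun x => (match x with
        | none => pure .nil
        | some (S, r') => S.unrank p.length r' : Cost Plan).val) (fun _ _ => rfl)
      (table m p s t) (fun S hS => Split.bijOn_unrank (hT S hS) ih) ?_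
    · simp only [unrankPlan_eq]; exact this
    · refine List.Pairwise.imp_of_mem ?_ (nodup_table m p s t)
      intro S S' hS hS' hne
      refine Set.disjoint_left.2 fun P hP hP' => hne ?_
      exact Split.eq_of_plans (hT S hS) (hT S' hS') hP hP' rfl

/-! ### The cost of unranking plans -/

/-- The number of trees with the given parameters. -/
noncomputable def numSkeletons (m : ℕ) (p : List ℕ) (s : ℕ) (t : List ℕ) : ℕ :=
  (Plan.skeleton '' validPlans m p s t).ncard

theorem finite_validPlans (m : ℕ) (p : List ℕ) (s : ℕ) (t : List ℕ) :
    (validPlans m p s t).Finite := by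
  rw [← (bijOn_unrankPlan m p s t).image_eq]
  exact (Set.finite_Iio _).image _

/-- Picking one plan from each `B a` and forgetting its choices is injective on the list, by `hsep`.
Applied to lists of splits and to lists of profiles, it bounds the length of a sequential search. -/
theorem length_le_ncard_skeletons {α : Type} {L : List α} (hL : L.Nodup) {X : Set Plan}
    (hX : X.Finite) (B : α → Set Plan) (hB : ∀ a ∈ L, (B a).Nonempty) (hBX : ∀ a ∈ L, B a ⊆ X)
    (hsep : ∀ a ∈ L, ∀ b ∈ L, ∀ P ∈ B a, ∀ Q ∈ B b, P.skeleton = Q.skeleton → a = b) :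
    L.length ≤ (Plan.skeleton '' X).ncard := by
  classical
  have hc : ∀ a, ∃ P, a ∈ L → P ∈ B a := by
    intro a
    by_cases h : a ∈ L
    · exact ⟨_, fun _ => (hB a h).choose_spec⟩
    · exact ⟨.nil, fun h' => absurd h' h⟩
  choose F hF using hc
  rw [← List.toFinset_card_of_nodup hL, ← Set.ncard_coe_finset]
  refine Set.ncard_le_ncard_of_injOn (fun a => (F a).skeleton) (fun a ha => ?_)
    (fun a ha b hb he => ?_) (hX.image _)
  · have ha : a ∈ L := by simpa using ha
    exact ⟨_, hBX a ha (hF a ha), rfl⟩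
  · have ha : a ∈ L := by simpa using ha
    have hb : b ∈ L := by simpa using hb
    exact hsep a ha b hb _ (hF a ha) _ (hF b hb) he

theorem mem_table {m : ℕ} {p : List ℕ} {s : ℕ} {t : List ℕ} {S : Split m} :
    S ∈ table m p s t ↔ S ∈ splits m p s ∧ S.profile p.length = t := by
  simp [table]

theorem Split.plans_subset {m : ℕ} {p : List ℕ} {s : ℕ} {t : List ℕ} {S : Split m}
    (h : S ∈ table m p s t) : S.plans p s ⊆ validPlans m p s t :=
  fun _ hP => (mem_validPlans_iff fun n _ => bijOn_unrankPlan n).2 ⟨S, h, hP⟩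

theorem Split.plans_nonempty {m : ℕ} {p : List ℕ} {s : ℕ} {S : Split m}
    (h : S ∈ splits m p s) : (S.plans p s).Nonempty :=
  ⟨_, (Split.bijOn_unrank h fun n _ => bijOn_unrankPlan n).mapsTo (splits_weight_pos h)⟩

theorem length_table_le (m : ℕ) (p : List ℕ) (s : ℕ) (t : List ℕ) :
    (table m p s t).length ≤ numSkeletons m p s t :=
  length_le_ncard_skeletons (nodup_table m p s t) (finite_validPlans m p s t) (Split.plans p s)
    (fun _ hS => Split.plans_nonempty (mem_table.1 hS).1) (fun _ hS => Split.plans_subset hS)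
    fun _ hS _ hS' _ hP _ hP' he =>
      Split.eq_of_plans (mem_table.1 hS).1 (mem_table.1 hS').1 hP hP' he

/-- Left and right subtrees of a split combine freely: by `Split.weight_eq` the number of choices is
positive for every pair, since the weight is, so choice `0` is always available. -/
theorem Split.node_mem_plans {m : ℕ} {p : List ℕ} {s : ℕ} {S : Split m} (h : S ∈ splits m p s)
    {P Q : Plan} (hP : P ∈ S.left.plans) (hQ : Q ∈ S.right.plans) :
    Plan.node p.length 0 P Q ∈ S.plans p s := by
  obtain ⟨h0, h1, h2, h3, h4⟩ := mem_splits.1 h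
  have hw := Split.weight_eq (s := s) h0 h1 h2 hP hQ
  rw [← h3] at hw
  refine ⟨0, P, Q, rfl, hP, hQ, Nat.pos_of_ne_zero fun h' => ?_⟩
  rw [h', mul_zero] at hw
  omega

theorem Split.plans_left_right_nonempty {m : ℕ} {p : List ℕ} {s : ℕ} {S : Split m}
    (h : S ∈ splits m p s) : S.left.plans.Nonempty ∧ S.right.plans.Nonempty := by
  obtain ⟨_, _, l, r, rfl, hl, hr, -⟩ := Split.plans_nonempty h
  exact ⟨⟨l, hl⟩, ⟨r, hr⟩⟩

/-- With one right subtree fixed, grafting embeds the left spines into the spines of the whole tree.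
-/
theorem Split.ncard_left_le {m : ℕ} {p : List ℕ} {s : ℕ} {t : List ℕ} {S : Split m}
    (h : S ∈ table m p s t) :
    (Plan.skeleton '' S.left.plans).ncard ≤ numSkeletons m p s t := by
  obtain ⟨Q, hQ⟩ := (Split.plans_left_right_nonempty (mem_table.1 h).1).2
  refine Set.ncard_le_ncard_of_injOn (fun T => .node p.length T Q.skeleton) ?_
    (fun a _ b _ he => by simpa using he) ((finite_validPlans m p s t).image _)
  rintro _ ⟨P, hP, rfl⟩
  exact ⟨_, Split.plans_subset h (Split.node_mem_plans (mem_table.1 h).1 hP hQ), rfl⟩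

theorem Split.ncard_right_le {m : ℕ} {p : List ℕ} {s : ℕ} {t : List ℕ} {S : Split m}
    (h : S ∈ table m p s t) :
    (Plan.skeleton '' S.right.plans).ncard ≤ numSkeletons m p s t := by
  obtain ⟨P, hP⟩ := (Split.plans_left_right_nonempty (mem_table.1 h).1).1
  refine Set.ncard_le_ncard_of_injOn (fun T => .node p.length P.skeleton T) ?_
    (fun a _ b _ he => by simpa using he) ((finite_validPlans m p s t).image _)
  rintro _ ⟨Q, hQ, rfl⟩
  exact ⟨_, Split.plans_subset h (Split.node_mem_plans (mem_table.1 h).1 hP hQ), rfl⟩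

/-- The `4` counts the two tests for emptiness, the quotient and the remainder. The recursive bounds
add up because the subtrees have `m - 1` nodes together and neither has more possible spines than
the whole. -/
theorem Split.ops_unrank_le {m : ℕ} {p : List ℕ} {s : ℕ} {t : List ℕ} {S : Split m}
    (hS : S ∈ table m p s t)
    (ih : ∀ n < m, ∀ p s t, ∀ r < totalWeight n p s t,
      (unrankPlan n p s t r).ops ≤ 6 * (n * numSkeletons n p s t)) (r : ℕ) (hr : r < S.weight) :
    (S.unrank p.length r).ops ≤ 4 + 6 * ((m - 1) * numSkeletons m p s t) := by
  have hl := Split.ncard_left_le hS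
  have hr' := Split.ncard_right_le hS
  obtain ⟨h0, h1, h2, h3, h4⟩ := mem_splits.1 (mem_table.1 hS).1
  obtain ⟨L, R, w⟩ := S
  simp only at hl hr' h0 h1 h2 h3 h4 hr
  have ihe : ∀ {e : SubEntry m} {q w}, e.IsFor q w → e.size ≠ 0 →
      (Plan.skeleton '' e.plans).ncard ≤ numSkeletons m p s t → ∀ r < e.weight,
      (e.unrank r).ops ≤ 6 * (e.size * numSkeletons m p s t) := by
    intro e q w he h hle r hr
    obtain ⟨j, -, -, -, -, hw, -⟩ := (he.resolve_left (fun h' => h h'.1)).2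
    rw [SubEntry.plans_of_size h] at hle
    refine (ih _ e.size_lt _ _ _ r (hw ▸ hr)).trans ?_
    exact Nat.mul_le_mul_left _ (Nat.mul_le_mul_left _ hle)
  have hsum : (m - 1) * numSkeletons m p s t =
      L.size * numSkeletons m p s t + R.size * numSkeletons m p s t := by
    rw [← add_mul, show m - 1 = L.size + R.size by omega]
  rw [hsum]
  -- The bounds of the induction hypothesis hold only for ranks in range, so both parts of the
  -- divided rank must be checked.
  have hq : R.size ≠ 0 ∨ L.size ≠ 0 → r / R.weight < L.weight ∧ r % R.weight < R.weight := by
    intro h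
    have hm : m ≠ 1 := by omega
    rw [if_neg hm, Nat.sub_zero] at h3
    have hR : 0 < R.weight := by
      rcases Nat.eq_zero_or_pos R.weight with h' | h'
      · rw [h', mul_zero] at h3; omega
      · exact h'
    exact ⟨(Nat.div_lt_iff_lt_mul hR).2 (h3 ▸ hr), Nat.mod_lt _ hR⟩
  by_cases hL : L.size = 0 <;> by_cases hR : R.size = 0
  · simp [Split.unrank, hL, hR]
  · have := ihe h2 hR hr' _ (hq (Or.inl hR)).2
    simp [Split.unrank, hL, hR]
    omega
  · have := ihe h1 hL hl _ (hq (Or.inr hL)).1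
    simp [Split.unrank, hL, hR]
    omega
  · have e1 := ihe h1 hL hl _ (hq (Or.inr hL)).1
    have e2 := ihe h2 hR hr' _ (hq (Or.inr hL)).2
    simp [Split.unrank, hL, hR]
    omega

theorem ops_unrankPlan_le (m : ℕ) : ∀ (p : List ℕ) (s : ℕ) (t : List ℕ),
    ∀ r < totalWeight m p s t,
      (unrankPlan m p s t r).ops ≤ 6 * (m * numSkeletons m p s t) := by
  induction m using Nat.strong_induction_on with
  | _ m ih =>
    intro p s t r hr
    obtain ⟨S, hS, r', hr', hsel⟩ := select_val Split.weight (table m p s t) r hr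
    have h1 := select_ops Split.weight (table m p s t) r
    have h2 := Split.ops_unrank_le hS ih r' hr'
    have h3 := length_table_le m p s t
    -- The list is not empty, so there is at least one spine, and the additive `4` is at most four
    -- times their number. With `2` per searched item this gives the constant `6`.
    have h4 := List.length_pos_of_mem hS
    obtain ⟨m, rfl⟩ : ∃ n, m = n + 1 :=
      ⟨m - 1, by have := (mem_splits.1 (mem_table.1 hS).1).1; omega⟩
    rw [unrankPlan_eq, Cost.ops_bind, hsel]
    rw [Nat.add_sub_cancel] at h2
    rw [add_mul, one_mul]
    refine (Nat.add_le_add h1 h2).trans ?_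
    omega

/-! ### Unranking of all plans -/

/-- The total weight of the trees with `m` nodes, pool profile `p` and level rank `s`. -/
def countSum (m : ℕ) (p : List ℕ) (s : ℕ) : ℕ := ((count m p s).map Prod.snd).sum

/-- All plans with `m` nodes for diagrams of index `k`. -/
def allPlans (m k : ℕ) : Set Plan := {P | P.Valid (initialPool k) 0 ∧ P.skeleton.size = m}

/-- Identification of the profile and unranking of the plan. -/
def unrankAny (m : ℕ) (p : List ℕ) (s : ℕ) (r : ℕ) : Cost Plan := do
  let found ← select Prod.snd (count m p s) r
  match found with
  | none => pure .nil
  | some (e, r') => unrankPlan m p s e.1 r'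

theorem exists_mem_count_iff {m : ℕ} {p : List ℕ} {s : ℕ} {P : Plan} :
    (P.Valid p s ∧ P.skeleton.size = m) ↔ ∃ e ∈ count m p s, P ∈ validPlans m p s e.1 := by
  constructor
  · rintro ⟨h1, h2⟩
    have hP : P ∈ validPlans m p s P.skeleton.profile := ⟨h1, h2, rfl⟩
    obtain ⟨r, hr, -⟩ := (bijOn_unrankPlan m p s _).surjOn hP
    have hr : r < _ := hr
    exact ⟨(P.skeleton.profile, _), mem_count.2 ⟨rfl, by omega⟩, hP⟩
  · rintro ⟨e, -, h1, h2, -⟩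
    exact ⟨h1, h2⟩

theorem nodup_count (m : ℕ) (p : List ℕ) (s : ℕ) : (count m p s).Nodup :=
  List.Nodup.of_map _ (nodup_keys_collect _ _)

theorem count_eq_of_fst {m : ℕ} {p : List ℕ} {s : ℕ} {e e' : List ℕ × ℕ} (h : e ∈ count m p s)
    (h' : e' ∈ count m p s) (hee : e.1 = e'.1) : e = e' :=
  Prod.ext hee (by rw [(mem_count.1 h).1, (mem_count.1 h').1, hee])

theorem bijOn_unrankAny (m : ℕ) (p : List ℕ) (s : ℕ) :
    Set.BijOn (fun r => (unrankAny m p s r).val) (Set.Iio (countSum m p s))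
      {P | P.Valid p s ∧ P.skeleton.size = m} := by
  have e : {P : Plan | P.Valid p s ∧ P.skeleton.size = m} =
      {P | ∃ e ∈ count m p s, P ∈ validPlans m p s e.1} := Set.ext fun P => exists_mem_count_iff
  rw [e]
  refine bijOn_select Prod.snd (fun e r => (unrankPlan m p s e.1 r).val)
    (fun e => validPlans m p s e.1)
    (fun x => (match x with
        | none => pure .nil
        | some (e, r') => unrankPlan m p s e.1 r' : Cost Plan).val) (fun _ _ => rfl)
    (count m p s) (fun e he => ?_) ?_
  · rw [(mem_count.1 he).1]
    exact bijOn_unrankPlan m p s e.1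
  · refine List.Pairwise.imp_of_mem ?_ (nodup_count m p s)
    intro e e' he he' hne
    refine Set.disjoint_left.2 fun P hP hP' => hne ?_
    exact count_eq_of_fst he he' (hP.2.2.symm.trans hP'.2.2)

/-- The extra `2` is the search for the profile: different profiles belong to different spines, so
there are at most as many profiles as spines. -/
theorem ops_unrankAny_le (m : ℕ) (p : List ℕ) (s : ℕ) (r : ℕ) (hr : r < countSum m p s) :
    (unrankAny m p s r).ops ≤
      (6 * m + 2) * (Plan.skeleton '' {P | P.Valid p s ∧ P.skeleton.size = m}).ncard := by
  set X := {P : Plan | P.Valid p s ∧ P.skeleton.size = m}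
  have hX : X.Finite := by
    have : X = _ := (bijOn_unrankAny m p s).image_eq.symm
    rw [this]
    exact (Set.finite_Iio _).image _
  have hsub : ∀ t, validPlans m p s t ⊆ X := fun t P hP => ⟨hP.1, hP.2.1⟩
  obtain ⟨e, he, r', hr', hsel⟩ := select_val Prod.snd (count m p s) r hr
  have h1 := select_ops Prod.snd (count m p s) r
  have h2 := ops_unrankPlan_le m p s e.1 r' ((mem_count.1 he).1 ▸ hr')
  have h3 : numSkeletons m p s e.1 ≤ (Plan.skeleton '' X).ncard :=
    Set.ncard_le_ncard (Set.image_mono (hsub _)) (hX.image _)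
  have h4 : (count m p s).length ≤ (Plan.skeleton '' X).ncard := by
    refine length_le_ncard_skeletons (nodup_count m p s) hX (fun e => validPlans m p s e.1)
      (fun e he => ?_) (fun _ _ => hsub _) ?_
    · obtain ⟨e1, e2⟩ := mem_count.1 he
      exact ⟨_, (bijOn_unrankPlan m p s e.1).mapsTo (show 0 < _ from e1 ▸ e2)⟩
    · intro a ha b hb P hP Q hQ hPQ
      refine count_eq_of_fst ha hb ?_
      rw [← hP.2.2, ← hQ.2.2, hPQ]
  rw [unrankAny, Cost.ops_bind, hsel]
  refine (Nat.add_le_add h1 h2).trans ?_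
  have h5 := Nat.mul_le_mul_left (6 * m) h3
  rw [mul_assoc] at h5
  rw [add_mul]
  omega

/-! ### Lists of finished nodes -/

/-- The number of sinks and finished nodes of index `j`. -/
def countIdx (D : List Record) (j : ℕ) : ℕ :=
  D.countP (fun R => R.idx = j) + if j = 0 then 2 else 0

/-- The pool profile of a node of index `i`. -/
def poolOf (D : List Record) (i : ℕ) : List ℕ := (List.range i).map (countIdx D)

/-- The lists of finished nodes of a reduced diagram in a bottom-up order. -/
inductive WellFormed : List Record → Prop
  | nil : WellFormed []
  | snoc {D : List Record} {R : Record} (hD : WellFormed D) (idx_pos : 0 < R.idx)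
      (low_mem : R.low ∈ candidates D R.idx) (high_mem : R.high ∈ candidates D R.idx)
      (low_ne_high : R.low ≠ R.high)
      (unshared : (R.idx, R.low, R.high) ∉ D.map fun R => (R.idx, R.low, R.high)) :
      WellFormed (D ++ [R])

theorem length_poolOf (D : List Record) (i : ℕ) : (poolOf D i).length = i := by simp [poolOf]

theorem getD_poolOf (D : List Record) {i j : ℕ} (h : j < i) :
    (poolOf D i).getD j 0 = countIdx D j := by
  simp [poolOf, h]

theorem take_poolOf (D : List Record) {i j : ℕ} (h : j ≤ i) :
    (poolOf D i).take j = poolOf D j := by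
  simp [poolOf, ← List.map_take, List.take_range, h]

theorem mem_candidates {D : List Record} {i : ℕ} {q : Vertex ℕ} :
    q ∈ candidates D i ↔
      (∃ b, q = .sink b) ∨ ∃ j R, q = .node j ∧ D[j]? = some R ∧ R.idx < i := by
  simp only [candidates, List.mem_append, List.mem_cons, List.not_mem_nil, or_false, List.mem_map,
    List.mem_filter, List.mem_zipIdx_iff_getElem?, decide_eq_true_eq, Bool.exists_bool]
  constructor
  · rintro (h | ⟨⟨R, j⟩, ⟨h1, h2⟩, rfl⟩)
    · exact Or.inl h
    · exact Or.inr ⟨j, R, rfl, h1, h2⟩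
  · rintro (h | ⟨j, R, rfl, h1, h2⟩)
    · exact Or.inl h
    · exact Or.inr ⟨(R, j), ⟨h1, h2⟩, rfl⟩

theorem nodup_candidates (D : List Record) (i : ℕ) : (candidates D i).Nodup := by
  unfold candidates
  rw [List.nodup_append']
  refine ⟨by simp, ?_, ?_⟩
  · have h : (D.zipIdx.map Prod.snd).Nodup := by
      rw [List.zipIdx_map_snd]
      exact List.nodup_range'
    have h2 : ((D.zipIdx.filter fun x => x.1.idx < i).map Prod.snd).Nodup :=
      h.sublist (List.filter_sublist.map _)
    have := h2.map (f := Vertex.node) (fun a b h => by simpa using h)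
    rwa [List.map_map] at this
  · intro a ha hb
    simp only [List.mem_cons, List.not_mem_nil, or_false] at ha
    obtain ⟨_, -, h⟩ := List.mem_map.1 hb
    rcases ha with rfl | rfl <;> cases h

theorem length_candidates (D : List Record) (i : ℕ) :
    (candidates D i).length = 2 + D.countP fun R => R.idx < i := by
  have h : (D.zipIdx.filter fun x => x.1.idx < i).length =
      (D.zipIdx.map Prod.fst).countP fun R => R.idx < i := by
    rw [List.countP_map, List.countP_eq_length_filter]
    rfl
  rw [List.zipIdx_map_fst] at h
  simp only [candidates, List.length_append, List.length_map, h, List.length_cons,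
    List.length_nil]

/-- The two sinks are counted in the component of index `0`, which exists only for positive `i`. -/
theorem sum_poolOf (D : List Record) {i : ℕ} (hi : 0 < i) :
    (poolOf D i).sum = (candidates D i).length := by
  have key : ∀ i, (poolOf D i).sum = (if 0 < i then 2 else 0) + D.countP fun R => R.idx < i := by
    intro i
    induction i with
    | zero => simp [poolOf]
    | succ i ih =>
      have h : (D.countP fun R => R.idx < i + 1) =
          (D.countP fun R => R.idx < i) + D.countP fun R => R.idx = i := by
        clear ih
        induction D with
        | nil => rfl
        | cons R D ih =>
          simp only [List.countP_cons, ih, decide_eq_true_eq]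
          split_ifs <;> omega
      unfold poolOf at ih ⊢
      rw [List.range_succ, List.map_append, List.sum_append, ih, h]
      simp only [List.map_cons, List.map_nil, List.sum_cons, List.sum_nil, countIdx]
      split_ifs <;> omega
  rw [key, if_pos hi, length_candidates]

theorem candidates_mono {D E : List Record} (h : D <+: E) {i j : ℕ} (hij : i ≤ j) {q : Vertex ℕ}
    (hq : q ∈ candidates D i) : q ∈ candidates E j := by
  rw [mem_candidates] at hq ⊢
  refine hq.imp id ?_
  rintro ⟨n, R, rfl, h1, h2⟩
  obtain ⟨F, rfl⟩ := h
  refine ⟨n, R, rfl, ?_, by omega⟩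
  rw [List.getElem?_append_left (List.getElem?_eq_some_iff.1 h1).1, h1]

theorem WellFormed.getElem {D : List Record} (hD : WellFormed D) {j : ℕ} {R : Record}
    (h : D[j]? = some R) : 0 < R.idx ∧ R.low ∈ candidates (D.take j) R.idx ∧
      R.high ∈ candidates (D.take j) R.idx ∧ R.low ≠ R.high ∧
      (R.idx, R.low, R.high) ∉ (D.take j).map fun R => (R.idx, R.low, R.high) := by
  induction hD generalizing j with
  | nil => simp at h
  | @snoc D R' hD h1 h2 h3 h4 h5 ih =>
    rcases lt_trichotomy j D.length with hj | rfl | hj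
    · rw [List.getElem?_append_left hj] at h
      rw [List.take_append_of_le_length hj.le]
      exact ih h
    · simp only [List.getElem?_concat_length, Option.some.injEq] at h
      subst h
      rw [List.take_left]
      exact ⟨h1, h2, h3, h4, h5⟩
    · rw [List.getElem?_eq_none (by simpa using hj)] at h
      simp at h

theorem lt_of_mem_candidates_take {D : List Record} {i j u : ℕ}
    (h : Vertex.node u ∈ candidates (D.take j) i) : u < j ∧ ∃ R, D[u]? = some R ∧ R.idx < i := by
  rw [mem_candidates] at h
  obtain ⟨b, hb⟩ | ⟨n, R, hn, h1, h2⟩ := h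
  · cases hb
  · cases hn
    have := (List.getElem?_eq_some_iff.1 h1).1
    rw [List.length_take] at this
    rw [List.getElem?_take_of_lt (by omega)] at h1
    exact ⟨by omega, R, h1, h2⟩

theorem WellFormed.child_lt {D : List Record} (hD : WellFormed D) {j : ℕ} {R : Record}
    (h : D[j]? = some R) {u : ℕ} (hu : R.low = .node u ∨ R.high = .node u) : u < j := by
  obtain ⟨-, h1, h2, -⟩ := hD.getElem h
  rcases hu with hu | hu
  · rw [hu] at h1; exact (lt_of_mem_candidates_take h1).1
  · rw [hu] at h2; exact (lt_of_mem_candidates_take h2).1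

/-- Children have smaller numbers than their parents. A pair of children containing the node
finished last is therefore always new. -/
theorem WellFormed.lastNode_not_child {D : List Record} (hD : WellFormed D) {R : Record}
    (h : R ∈ D) : R.low ≠ lastNode D ∧ R.high ≠ lastNode D := by
  obtain ⟨j, hj⟩ := List.mem_iff_getElem?.1 h
  have h1 := (List.getElem?_eq_some_iff.1 hj).1
  constructor <;> intro h2
  · have := hD.child_lt hj (Or.inl h2); omega
  · have := hD.child_lt hj (Or.inr h2); omega

theorem WellFormed.nodup_triples {D : List Record} (hD : WellFormed D) :
    (D.map fun R => (R.idx, R.low, R.high)).Nodup := by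
  induction hD with
  | nil => simp
  | snoc hD h1 h2 h3 h4 h5 ih =>
    rw [List.map_append, List.nodup_append']
    refine ⟨ih, by simp, ?_⟩
    simpa [List.disjoint_singleton] using h5

theorem mem_candidatePairs {D : List Record} {i : ℕ} {x y : Vertex ℕ} :
    (x, y) ∈ candidatePairs D i ↔ x ∈ candidates D i ∧ y ∈ candidates D i ∧ x ≠ y ∧
      (i, x, y) ∉ D.map fun R => (R.idx, R.low, R.high) := by
  simp only [candidatePairs, List.mem_filter, List.pair_mem_product, decide_eq_true_eq]
  tauto

theorem nodup_candidatePairs (D : List Record) (i : ℕ) : (candidatePairs D i).Nodup :=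
  ((nodup_candidates D i).product (nodup_candidates D i)).filter _

/-- The pairs used at index `i` are pairwise distinct because the nodes are unshared, and they are
off-diagonal pairs of present candidates because candidates are never lost. So exactly `countIdx D
i` pairs are removed. -/
theorem length_candidatePairs {D : List Record} (hD : WellFormed D) {i : ℕ} (hi : 0 < i) :
    (candidatePairs D i).length = (candidates D i).length * ((candidates D i).length - 1) -
      countIdx D i := by
  classical
  set U := (D.filter fun R => R.idx = i).map fun R => (R.low, R.high) with hU
  have hUn : U.Nodup := by
    have h := (hD.nodup_triples.sublist
      ((List.filter_sublist (p := fun R => decide (R.idx = i))).map _))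
    rw [hU]
    refine List.Nodup.of_map (fun x => (i, x)) ?_
    rw [List.map_map]
    convert h using 1
    refine List.map_congr_left fun R hR => ?_
    have : R.idx = i := by simpa using (List.mem_filter.1 hR).2
    simp [this]
  have hmem : ∀ x y, (x, y) ∈ U ↔ (i, x, y) ∈ D.map fun R => (R.idx, R.low, R.high) := by
    intro x y
    simp only [hU, List.mem_map, List.mem_filter, Prod.mk.injEq, decide_eq_true_eq]
    constructor
    · rintro ⟨R, ⟨h1, h2⟩, h3, h4⟩; exact ⟨R, h1, h2, h3, h4⟩
    · rintro ⟨R, h1, h2, h3, h4⟩; exact ⟨R, ⟨h1, h2⟩, h3, h4⟩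
  have hUl : U.length = countIdx D i := by
    rw [hU, List.length_map, countIdx, if_neg hi.ne', add_zero, List.countP_eq_length_filter]
  have hsub : U.toFinset ⊆ (candidates D i).toFinset.offDiag := by
    rintro ⟨x, y⟩ hxy
    rw [List.mem_toFinset, hmem, List.mem_map] at hxy
    obtain ⟨R, hR, h⟩ := hxy
    simp only [Prod.mk.injEq] at h
    obtain ⟨rfl, rfl, rfl⟩ := h
    obtain ⟨j, hj⟩ := List.mem_iff_getElem?.1 hR
    obtain ⟨-, h1, h2, h3, -⟩ := hD.getElem hj
    rw [Finset.mem_offDiag, List.mem_toFinset, List.mem_toFinset]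
    exact ⟨candidates_mono (List.take_prefix _ _) le_rfl h1,
      candidates_mono (List.take_prefix _ _) le_rfl h2, h3⟩
  have heq : (candidatePairs D i).toFinset =
      (candidates D i).toFinset.offDiag \ U.toFinset := by
    ext ⟨x, y⟩
    rw [List.mem_toFinset, mem_candidatePairs, Finset.mem_sdiff, Finset.mem_offDiag,
      List.mem_toFinset, List.mem_toFinset, List.mem_toFinset, hmem]
    tauto
  rw [← List.toFinset_card_of_nodup (nodup_candidatePairs D i), heq,
    Finset.card_sdiff_of_subset hsub, Finset.offDiag_card,
    List.toFinset_card_of_nodup (nodup_candidates D i), List.toFinset_card_of_nodup hUn, hUl,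
    Nat.mul_sub, mul_one]

/-! ### Completing a spine -/

/-- The children of a node of index `i` with choice `c` and subtrees `l`, `h`, where `D₁`, `D₂` are
the finished nodes after the construction of `l` and of `h`. -/
def children (i c : ℕ) (l h : Plan) (D₁ D₂ : List Record) : Vertex ℕ × Vertex ℕ :=
  match l, h with
  | .nil, .nil => (candidatePairs D₁ i).getD c (.sink false, .sink true)
  | .nil, .node .. => ((candidates D₁ i).getD c (.sink false), lastNode D₂)
  | .node .., .nil => (lastNode D₁,
      ((candidates D₁ i).filter fun q => q ≠ lastNode D₁).getD c (.sink false))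
  | .node .., .node .. => (lastNode D₁, lastNode D₂)

/-- The choice for which the children are `x` and `y`. -/
def choice (i : ℕ) (x y : Vertex ℕ) (l h : Plan) (D₁ : List Record) : ℕ :=
  match l, h with
  | .nil, .nil => (candidatePairs D₁ i).idxOf (x, y)
  | .nil, .node .. => (candidates D₁ i).idxOf x
  | .node .., .nil => ((candidates D₁ i).filter fun q => q ≠ lastNode D₁).idxOf y
  | .node .., .node .. => 0

/-- The number of choices. -/
def numChildren (i : ℕ) (l h : Plan) (D₁ : List Record) : ℕ :=
  match l, h with
  | .nil, .nil => (candidatePairs D₁ i).length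
  | .nil, .node .. => (candidates D₁ i).length
  | .node .., .nil => ((candidates D₁ i).filter fun q => q ≠ lastNode D₁).length
  | .node .., .node .. => 1

/-- Together with `choice_lt` it makes `choice` and `children` inverse to each other; candidate
lists have no repetitions, so a position determines the element and conversely. -/
theorem choice_children {i c : ℕ} {l h : Plan} {D₁ : List Record} (hc : c < numChildren i l h D₁)
    (D₂ : List Record) :
    choice i (children i c l h D₁ D₂).1 (children i c l h D₁ D₂).2 l h D₁ = c := by
  cases l <;> cases h <;> simp only [numChildren] at hc <;> simp only [choice, children]
  · rw [List.getD_eq_getElem _ _ hc]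
    exact (nodup_candidatePairs D₁ i).idxOf_getElem _ hc
  · rw [List.getD_eq_getElem _ _ hc]
    exact (nodup_candidates D₁ i).idxOf_getElem _ hc
  · rw [List.getD_eq_getElem _ _ hc]
    exact ((nodup_candidates D₁ i).filter _).idxOf_getElem _ hc
  · omega

theorem getD_idxOf {α : Type} [BEq α] [LawfulBEq α] {L : List α} {a d : α} (h : a ∈ L) :
    L.getD (L.idxOf a) d = a := by
  rw [List.getD_eq_getElem _ _ (List.idxOf_lt_length_of_mem h), List.getElem_idxOf]

/-- The possible pairs of children. -/
def IsChildren (i : ℕ) (x y : Vertex ℕ) (l h : Plan) (D₁ D₂ : List Record) : Prop :=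
  x ∈ candidates D₂ i ∧ y ∈ candidates D₂ i ∧ x ≠ y ∧
    ((i, x, y) ∉ D₂.map fun R => (R.idx, R.low, R.high)) ∧
    (l = .nil → x ∈ candidates D₁ i) ∧ (l ≠ .nil → x = lastNode D₁) ∧
    (h = .nil → y ∈ candidates D₁ i) ∧ (h ≠ .nil → y = lastNode D₂)

theorem choice_lt {i : ℕ} {x y : Vertex ℕ} {l h : Plan} {D₁ D₂ : List Record}
    (hxy : IsChildren i x y l h D₁ D₂) (hD : h = .nil → D₂ = D₁) :
    choice i x y l h D₁ < numChildren i l h D₁ ∧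
      children i (choice i x y l h D₁) l h D₁ D₂ = (x, y) := by
  obtain ⟨h1, h2, h3, h4, h5, h6, h7, h8⟩ := hxy
  cases l <;> cases h <;> simp only [choice, children, numChildren]
  · rw [hD rfl] at h4
    have := mem_candidatePairs.2 ⟨h5 rfl, h7 rfl, h3, h4⟩
    exact ⟨List.idxOf_lt_length_of_mem this, getD_idxOf this⟩
  · exact ⟨List.idxOf_lt_length_of_mem (h5 rfl), by rw [getD_idxOf (h5 rfl), h8 (by simp)]⟩
  · have hx := h6 (by simp)
    have : y ∈ (candidates D₁ i).filter fun q => q ≠ lastNode D₁ := by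
      simpa [h7] using hx ▸ h3.symm
    exact ⟨List.idxOf_lt_length_of_mem this, by rw [getD_idxOf this, hx]⟩
  · exact ⟨one_pos, by rw [h6 (by simp), h8 (by simp)]⟩

/-- The last of the finished nodes has index `j`. -/
def LastIdx (D : List Record) (j : ℕ) : Prop := ∃ R, D[D.length - 1]? = some R ∧ R.idx = j

theorem LastIdx.mem_candidates {D E : List Record} {i j : ℕ} (h : LastIdx D j) (hj : j < i)
    (hDE : D <+: E) : lastNode D ∈ candidates E i := by
  obtain ⟨R, hR, rfl⟩ := h
  exact candidates_mono hDE le_rfl (_root_.mem_candidates.2 (Or.inr ⟨_, R, rfl, hR, hj⟩))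

theorem LastIdx.length_pos {D : List Record} {j : ℕ} (h : LastIdx D j) : 0 < D.length := by
  obtain ⟨R, hR, -⟩ := h
  have := (List.getElem?_eq_some_iff.1 hR).1
  omega

theorem lastNode_not_mem_candidates {D E : List Record} (h : D.length < E.length) (i : ℕ) :
    lastNode E ∉ candidates D i := by
  rw [mem_candidates]
  rintro (⟨b, hb⟩ | ⟨j, R, hj, h1, -⟩)
  · cases hb
  · simp only [lastNode, Vertex.node.injEq] at hj
    have := (List.getElem?_eq_some_iff.1 h1).1
    omega

theorem isChildren_children {i c : ℕ} {l h : Plan} {D₁ D₂ : List Record}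
    (hc : c < numChildren i l h D₁) (hD : h = .nil → D₂ = D₁) (hD₂ : WellFormed D₂)
    (hpre : D₁ <+: D₂) (hl : l ≠ .nil → ∃ j < i, LastIdx D₁ j)
    (hh : h ≠ .nil → D₁.length < D₂.length ∧ ∃ j < i, LastIdx D₂ j) :
    IsChildren i (children i c l h D₁ D₂).1 (children i c l h D₁ D₂).2 l h D₁ D₂ := by
  -- No earlier node points to the node finished last, so the condition against sharing is automatic
  -- as soon as one child is the root of a new subtree.
  have fresh1 : ∀ y, (i, lastNode D₂, y) ∉ D₂.map fun R => (R.idx, R.low, R.high) := by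
    intro y hy
    obtain ⟨R, hR, h⟩ := List.mem_map.1 hy
    simp only [Prod.mk.injEq] at h
    exact (hD₂.lastNode_not_child hR).1 h.2.1
  have fresh2 : ∀ x, (i, x, lastNode D₂) ∉ D₂.map fun R => (R.idx, R.low, R.high) := by
    intro x hx
    obtain ⟨R, hR, h⟩ := List.mem_map.1 hx
    simp only [Prod.mk.injEq] at h
    exact (hD₂.lastNode_not_child hR).2 h.2.2
  cases l with
  | nil =>
    cases h with
    | nil =>
      obtain rfl := hD rfl
      simp only [numChildren] at hc
      simp only [children]
      rw [List.getD_eq_getElem _ _ hc]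
      have := List.getElem_mem hc
      obtain ⟨h1, h2, h3, h4⟩ := mem_candidatePairs.1 this
      exact ⟨h1, h2, h3, h4, fun _ => h1, fun h => absurd rfl h, fun _ => h2,
        fun h => absurd rfl h⟩
    | node =>
      obtain ⟨h1, j, hj, h2⟩ := hh (by simp)
      simp only [numChildren] at hc
      simp only [children]
      rw [List.getD_eq_getElem _ _ hc]
      have := List.getElem_mem hc
      refine ⟨candidates_mono hpre le_rfl this, h2.mem_candidates hj (List.prefix_refl _), ?_,
        fresh2 _, fun _ => this, fun h => absurd rfl h, fun h => by simp at h, fun _ => rfl⟩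
      intro h3
      rw [h3] at this
      exact lastNode_not_mem_candidates h1 i this
  | node =>
    obtain ⟨j, hj, h2⟩ := hl (by simp)
    cases h with
    | nil =>
      obtain rfl := hD rfl
      simp only [numChildren] at hc
      simp only [children]
      rw [List.getD_eq_getElem _ _ hc]
      have := List.getElem_mem hc
      rw [List.mem_filter] at this
      have h3 := of_decide_eq_true this.2
      exact ⟨h2.mem_candidates hj hpre, this.1, Ne.symm h3, fresh1 _, fun h => by simp at h,
        fun _ => rfl, fun _ => this.1, fun h => absurd rfl h⟩
    | node =>
      obtain ⟨h1, j', hj', h3⟩ := hh (by simp)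
      simp only [children]
      refine ⟨h2.mem_candidates hj hpre, h3.mem_candidates hj' (List.prefix_refl _), ?_,
        fresh2 _, fun h => by simp at h, fun _ => rfl, fun h => by simp at h, fun _ => rfl⟩
      intro h4
      have := h2.length_pos
      simp only [lastNode, Vertex.node.injEq] at h4
      omega

/-! ### The effect of `build` on the finished nodes -/

theorem build_node (i c : ℕ) (l h : Plan) (D : List Record) :
    (build (.node i c l h) D).val =
      (build h (build l D).val).val ++ [⟨i, (children i c l h (build l D).val
        (build h (build l D).val).val).1, (children i c l h (build l D).val
        (build h (build l D).val).val).2⟩] := by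
  cases l <;> cases h <;> rw [build] <;> first | rfl | simp

theorem build_nil (D : List Record) : (build .nil D).val = D := by simp [build]

theorem ops_build_le (P : Plan) (D : List Record) :
    (build P D).ops ≤ 2 * P.skeleton.size := by
  induction P generalizing D with
  | nil => simp [build]
  | node i c l h ihl ihh =>
    have h1 := ihl D
    have h2 := ihh (build l D).val
    cases l <;> cases h <;>
      simp [build, Plan.skeleton, Spine.size] at h1 h2 ⊢ <;> omega

theorem length_build (P : Plan) (D : List Record) :
    (build P D).val.length = D.length + P.skeleton.size := by
  induction P generalizing D with
  | nil => simp [build_nil, Plan.skeleton, Spine.size]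
  | node i c l h ihl ihh =>
    simp [build_node, ihl, ihh, Plan.skeleton, Spine.size]; omega

theorem prefix_build (P : Plan) (D : List Record) : D <+: (build P D).val := by
  induction P generalizing D with
  | nil => simp [build_nil]
  | node i c l h ihl ihh =>
    rw [build_node]
    exact ((ihl D).trans (ihh _)).trans (List.prefix_append _ _)

theorem countIdx_build (P : Plan) (D : List Record) (j : ℕ) :
    countIdx (build P D).val j = countIdx D j + P.skeleton.profile.getD j 0 := by
  induction P generalizing D with
  | nil => simp [build_nil, Plan.skeleton, Spine.profile]
  | node i c l h ihl ihh =>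
    have h1 : ∀ (D : List Record) (R : Record),
        countIdx (D ++ [R]) j = countIdx D j + if R.idx = j then 1 else 0 := by
      intro D R
      simp [countIdx, List.countP_append, List.countP_singleton, add_right_comm]
    have h2 : (unitProfile i).getD j 0 = if i = j then 1 else 0 := by
      unfold unitProfile
      rcases lt_trichotomy j i with h | rfl | h
      · rw [if_neg h.ne']
        rw [List.getD_append _ _ _ _ (by simpa using h)]
        simp [h]
      · simp
      · rw [if_neg h.ne]
        exact List.getD_eq_default _ _ (by simpa using h)
    rw [build_node, h1, ihh, ihl, Plan.skeleton, Spine.profile, getD_profileAdd, getD_profileAdd,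
      h2]
    simp only [add_assoc]

/-- The arithmetic update of the pool profile after the left subtree agrees with recounting the
finished nodes. The bound on the length keeps `profileAdd` from making the pool longer than `i`. -/
theorem profileAdd_poolOf {P : Plan} {D : List Record} {i : ℕ}
    (h : P.skeleton.profile.length ≤ i) :
    profileAdd (poolOf D i) P.skeleton.profile = poolOf (build P D).val i := by
  refine List.ext_getElem ?_ fun j h1 h2 => ?_
  · simp [length_profileAdd, length_poolOf, h]
  · rw [length_poolOf] at h2
    rw [← List.getD_eq_getElem _ 0, ← List.getD_eq_getElem _ 0, getD_profileAdd, getD_poolOf _ h2,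
      getD_poolOf _ h2, countIdx_build]

/-- Validity of a plan to be added to the finished nodes `D`. -/
def Plan.ValidAt (P : Plan) (D : List Record) (i : ℕ) : Prop :=
  P.Valid (poolOf D i) (countIdx D i)

theorem Plan.ValidAt.length_profile {P : Plan} {D : List Record} {i : ℕ} (h : P.ValidAt D i) :
    P.skeleton.profile.length = i + 1 := by
  rw [Plan.Valid.length_profile h, length_poolOf]

theorem Plan.ValidAt.index_eq {P : Plan} {D : List Record} {i : ℕ} (h : P.ValidAt D i) :
    P.skeleton.index = i := by
  rw [Plan.Valid.index_eq h, length_poolOf]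

/-- The weights used in counting are the lengths of the candidate lists used in building. For a
missing high child the `- 1` is the low child: it has just been finished with index below `i`, so it
is itself a candidate and has to be excluded. -/
theorem numChoices_eq {i : ℕ} (hi : 0 < i) {D : List Record} (hD : WellFormed D) {l h : Plan}
    (hl : l = .nil ∨ ∃ j < i, l.ValidAt D j ∧ LastIdx (build l D).val j) :
    numChoices (poolOf D i) (countIdx D i) l.skeleton h.skeleton =
      numChildren i l h (build l D).val := by
  cases l <;> cases h <;> simp only [Plan.skeleton, numChoices, numChildren]
  · rw [build_nil, length_candidatePairs hD hi, sum_poolOf _ hi]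
  · rw [build_nil, sum_poolOf _ hi]
  · obtain ⟨j, hj, h1, h2⟩ := hl.resolve_left (by simp)
    have h3 := profileAdd_poolOf (D := D) (i := i) (h1.length_profile.trans_le hj)
    rw [Plan.skeleton] at h3
    rw [h3, sum_poolOf _ hi]
    have h4 := h2.mem_candidates hj (List.prefix_refl _)
    rw [← List.length_erase_of_mem h4, (nodup_candidates _ i).erase_eq_filter]
    congr 2
    funext q
    rw [bne, decide_not]
    rfl

/-- Truncating the pool of index `i` at `j` gives the pool of index `j`, so validity of the subtrees
can be phrased by finished nodes alone. `hlast` is a hypothesis because inside the induction for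
`build_valid` only its instance for `l` is known. -/
theorem Plan.validAt_node {i c i' : ℕ} (hi : 0 < i) {l h : Plan} {D : List Record}
    (hD : WellFormed D)
    (hlast : ∀ j, 0 < j → l.ValidAt D j → LastIdx (build l D).val j) :
    (Plan.node i' c l h).ValidAt D i ↔ i' = i ∧ (l = .nil ∨ ∃ j < i, 0 < j ∧ l.ValidAt D j) ∧
      (h = .nil ∨ ∃ j < i, 0 < j ∧ h.ValidAt (build l D).val j) ∧
      c < numChildren i l h (build l D).val := by
  have key : ∀ (D : List Record) (Q : Plan), (1 ≤ Q.skeleton.index ∧ Q.skeleton.index < i ∧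
      Q.Valid ((poolOf D i).take Q.skeleton.index) ((poolOf D i).getD Q.skeleton.index 0)) ↔
      ∃ j < i, 0 < j ∧ Q.ValidAt D j := by
    intro D Q
    constructor
    · rintro ⟨h1, h2, h3⟩
      rw [take_poolOf _ h2.le, getD_poolOf _ h2] at h3
      exact ⟨_, h2, h1, h3⟩
    · rintro ⟨j, h1, h2, h3⟩
      obtain rfl := h3.index_eq
      rw [take_poolOf _ h1.le, getD_poolOf _ h1]
      exact ⟨h2, h1, h3⟩
  unfold Plan.ValidAt at *
  simp only [Plan.Valid]
  rw [length_poolOf, key]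
  refine and_congr_right fun _ => and_congr_right fun hl => ?_
  have h1 : profileAdd (poolOf D i) l.skeleton.profile = poolOf (build l D).val i := by
    refine profileAdd_poolOf ?_
    rcases hl with rfl | ⟨j, hj, -, hl⟩
    · simp [Plan.skeleton, Spine.profile]
    · exact (Plan.ValidAt.length_profile hl).trans_le hj
  rw [h1, length_poolOf, key, numChoices_eq hi hD]
  exact hl.imp id fun ⟨j, hj, hj', hl⟩ => ⟨j, hj, hl, hlast j hj' hl⟩

theorem LastIdx.concat (D : List Record) (R : Record) : LastIdx (D ++ [R]) R.idx :=
  ⟨R, by simp, rfl⟩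

/-- The root of a tree is its last finished node, and every other new node has a parent. The bound
on the indices and this last clause become `idx_le` and `unique_source` of the diagram. -/
theorem build_valid {P : Plan} : ∀ {D : List Record} {i : ℕ}, WellFormed D → 0 < i →
    P.ValidAt D i → WellFormed (build P D).val ∧ LastIdx (build P D).val i ∧
      (∀ j R, D.length ≤ j → (build P D).val[j]? = some R → R.idx ≤ i) ∧
      ∀ j, D.length ≤ j → j + 1 < (build P D).val.length →
        ∃ R ∈ (build P D).val, R.low = .node j ∨ R.high = .node j := by
  induction P with
  | nil => intro D i _ _ h; exact h.elim
  | node i' c l h ihl ihh =>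
    intro D i hD hi hP
    have hlast : ∀ j, 0 < j → l.ValidAt D j → LastIdx (build l D).val j :=
      fun j hj h => (ihl hD hj h).2.1
    obtain ⟨rfl, hl, hh, hc⟩ := (Plan.validAt_node hi hD hlast).1 hP
    set D₁ := (build l D).val with hD₁
    set D₂ := (build h D₁).val with hD₂
    have ihl : l ≠ .nil → ∃ j < i', WellFormed D₁ ∧ LastIdx D₁ j ∧
        (∀ n R, D.length ≤ n → D₁[n]? = some R → R.idx ≤ j) ∧
        ∀ n, D.length ≤ n → n + 1 < D₁.length → ∃ R ∈ D₁, R.low = .node n ∨ R.high = .node n := by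
      intro hn
      obtain ⟨j, hj, hj', hv⟩ := hl.resolve_left hn
      exact ⟨j, hj, ihl hD hj' hv⟩
    have wf₁ : WellFormed D₁ := by
      by_cases hn : l = .nil
      · rw [hD₁, hn, build_nil]; exact hD
      · exact (ihl hn).choose_spec.2.1
    have ihh : h ≠ .nil → ∃ j < i', WellFormed D₂ ∧ LastIdx D₂ j ∧
        (∀ n R, D₁.length ≤ n → D₂[n]? = some R → R.idx ≤ j) ∧
        ∀ n, D₁.length ≤ n → n + 1 < D₂.length →
          ∃ R ∈ D₂, R.low = .node n ∨ R.high = .node n := by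
      intro hn
      obtain ⟨j, hj, hj', hv⟩ := hh.resolve_left hn
      exact ⟨j, hj, ihh wf₁ hj' hv⟩
    have hnil : h = .nil → D₂ = D₁ := by
      intro hn; rw [hD₂, hn, build_nil]
    have hnil' : l = .nil → D₁ = D := by
      intro hn; rw [hD₁, hn, build_nil]
    have wf₂ : WellFormed D₂ := by
      by_cases hn : h = .nil
      · rw [hnil hn]; exact wf₁
      · exact (ihh hn).choose_spec.2.1
    have hpre : D₁ <+: D₂ := prefix_build h D₁
    have hlen : h ≠ .nil → D₁.length < D₂.length := by
      intro hn
      have hb := length_build h D₁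
      rw [← hD₂] at hb
      have : h.skeleton.size ≠ 0 := fun h' =>
        hn (Plan.skeleton_eq_nil.1 (Spine.size_eq_zero.1 h'))
      omega
    obtain ⟨c1, c2, c3, c4, c5, c6, c7, c8⟩ := isChildren_children hc hnil wf₂ hpre
      (fun hn => let ⟨j, hj, hv⟩ := ihl hn; ⟨j, hj, hv.2.1⟩)
      (fun hn => ⟨hlen hn, let ⟨j, hj, hv⟩ := ihh hn; ⟨j, hj, hv.2.1⟩⟩)
    rw [build_node, ← hD₁, ← hD₂]
    refine ⟨.snoc wf₂ hi c1 c2 c3 c4, LastIdx.concat _ _, fun j R hj hR => ?_, fun j hj hj' => ?_⟩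
    · rcases lt_trichotomy j D₂.length with hj2 | rfl | hj2
      · rw [List.getElem?_append_left hj2] at hR
        by_cases hj1 : j < D₁.length
        · obtain ⟨E, hE⟩ := hpre
          rw [← hE, List.getElem?_append_left hj1] at hR
          have hn : l ≠ .nil := fun hn => by rw [hnil' hn] at hj1; omega
          obtain ⟨j', hj', -, -, h1, -⟩ := ihl hn
          exact (h1 j R hj hR).trans hj'.le
        · have hn : h ≠ .nil := fun hn => by rw [hnil hn] at hj2; omega
          obtain ⟨j', hj', -, -, h1, -⟩ := ihh hn
          exact (h1 j R (by omega) hR).trans hj'.le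
      · simp only [List.getElem?_concat_length, Option.some.injEq] at hR
        rw [← hR]
      · rw [List.getElem?_eq_none (by simpa using hj2)] at hR
        simp at hR
    · rw [List.length_append, List.length_singleton] at hj'
      -- A non-root node of the left or right subtree has a parent inside it; the root of the
      -- subtree, its last node, is a child of the new node.
      by_cases hj1 : j < D₁.length
      · have hn : l ≠ .nil := fun hn => by rw [hnil' hn] at hj1; omega
        obtain ⟨_, _, -, -, -, h1⟩ := ihl hn
        by_cases hj2 : j + 1 < D₁.length
        · obtain ⟨R, hR, h2⟩ := h1 j hj hj2
          exact ⟨R, List.mem_append_left _ (hpre.subset hR), h2⟩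
        · refine ⟨_, List.mem_append_right _ (List.mem_singleton_self _), Or.inl ?_⟩
          simp only [c6 hn, lastNode, Vertex.node.injEq]
          omega
      · have hn : h ≠ .nil := fun hn => by rw [hnil hn] at hj'; omega
        obtain ⟨_, _, -, -, -, h1⟩ := ihh hn
        by_cases hj2 : j + 1 < D₂.length
        · obtain ⟨R, hR, h2⟩ := h1 j (by omega) hj2
          exact ⟨R, List.mem_append_left _ hR, h2⟩
        · refine ⟨_, List.mem_append_right _ (List.mem_singleton_self _), Or.inr ?_⟩
          simp only [c8 hn, lastNode, Vertex.node.injEq]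
          omega

/-! ### The diagram of a list of finished nodes -/

theorem toAutomaton_idx {m : ℕ} {L : List Record} {v : Fin m} {R : Record}
    (h : L[v.1]? = some R) : (toAutomaton m L).idx v = R.idx := by
  simp [toAutomaton, h]

theorem toAutomaton_low {m : ℕ} {L : List Record} {v : Fin m} {R : Record}
    (h : L[v.1]? = some R) : (toAutomaton m L).δ v false = toVertex m R.low := by
  simp [toAutomaton, h]

theorem toAutomaton_high {m : ℕ} {L : List Record} {v : Fin m} {R : Record}
    (h : L[v.1]? = some R) : (toAutomaton m L).δ v true = toVertex m R.high := by
  simp [toAutomaton, h]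

theorem toVertex_node {m j : ℕ} (h : j < m) : toVertex m (.node j) = .node ⟨j, h⟩ := by
  simp [toVertex, h]

theorem toVertex_inj {L : List Record} {i : ℕ} {x y : Vertex ℕ} (hx : x ∈ candidates L i)
    (hy : y ∈ candidates L i) (h : toVertex L.length x = toVertex L.length y) : x = y := by
  have key : ∀ x ∈ candidates L i, (toVertex L.length x).map Fin.val = x := by
    intro x hx
    rw [mem_candidates] at hx
    rcases hx with ⟨b, rfl⟩ | ⟨j, R, rfl, h, -⟩
    · rfl
    · rw [toVertex_node (List.getElem?_eq_some_iff.1 h).1]; rfl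
  rw [← key x hx, h, key y hy]

theorem index_toVertex_lt {L : List Record} {i j : ℕ} (hi : 0 < i) {x : Vertex ℕ}
    (hx : x ∈ candidates (L.take j) i) :
    (toAutomaton L.length L).index (toVertex L.length x) < i := by
  have hx := candidates_mono (List.take_prefix _ _) le_rfl hx
  rw [mem_candidates] at hx
  rcases hx with ⟨b, rfl⟩ | ⟨j, R, rfl, h, h'⟩
  · exact hi
  · rw [toVertex_node (List.getElem?_eq_some_iff.1 h).1, Automaton.index, toAutomaton_idx h]
    exact h'

/-- `WellFormed` provides all the local conditions. Uniqueness of the source combines `hin` with the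
fact that edges lead to smaller numbers, so that nothing points to the last node. -/
theorem isBDD_toAutomaton {L : List Record} {k : ℕ} (hL : WellFormed L) (hk : LastIdx L k)
    (hle : ∀ R ∈ L, R.idx ≤ k)
    (hin : ∀ j, j + 1 < L.length → ∃ R ∈ L, R.low = .node j ∨ R.high = .node j) :
    IsBDD k (toAutomaton L.length L) := by
  have hpos := hk.length_pos
  have hget : ∀ v : Fin L.length, L[v.1]? = some L[v.1] := fun v => List.getElem?_eq_getElem v.2
  have hδ : ∀ (v : Fin L.length) (u : ℕ) (α : Bool) (hu : u < L.length),
      (toAutomaton L.length L).δ v α = .node ⟨u, hu⟩ → u < v.1 := by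
    intro v u α hu h
    have aux : ∀ x ∈ candidates (L.take v) L[v.1].idx,
        toVertex L.length x = .node ⟨u, hu⟩ → u < v.1 := by
      intro x hx h
      rw [mem_candidates] at hx
      rcases hx with ⟨b, rfl⟩ | ⟨j, R, rfl, h', -⟩
      · cases h
      · have hj := (List.getElem?_eq_some_iff.1 h').1
        rw [List.length_take] at hj
        rw [toVertex_node (by omega)] at h
        simp only [Vertex.node.injEq, Fin.mk.injEq] at h
        omega
    obtain ⟨-, h1, h2, -⟩ := hL.getElem (hget v)
    cases α
    · rw [toAutomaton_low (hget v)] at h; exact aux _ h1 h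
    · rw [toAutomaton_high (hget v)] at h; exact aux _ h2 h
  have hroot : (toAutomaton L.length L).root = .node ⟨L.length - 1, by omega⟩ :=
    toVertex_node _
  refine ⟨fun v => ?_, ?_, fun v => ?_, fun u v huv hidx => ?_, fun v α => ?_, fun q => ?_⟩
  · rw [toAutomaton_idx (hget v)]
    exact hle _ (List.getElem_mem _)
  · obtain ⟨R, hR, h⟩ := hk
    rw [hroot, Automaton.index, toAutomaton_idx (R := R) hR, h]
  · obtain ⟨-, h1, h2, h3, -⟩ := hL.getElem (hget v)
    rw [toAutomaton_low (hget v), toAutomaton_high (hget v)]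
    exact fun h => h3 (toVertex_inj (candidates_mono (List.take_prefix _ _) le_rfl h1)
      (candidates_mono (List.take_prefix _ _) le_rfl h2) h)
  · rw [toAutomaton_idx (hget u), toAutomaton_idx (hget v)] at hidx
    rw [toAutomaton_low (hget u), toAutomaton_high (hget u), toAutomaton_low (hget v),
      toAutomaton_high (hget v)]
    obtain ⟨-, h1, h2, -⟩ := hL.getElem (hget u)
    obtain ⟨-, h1', h2', -⟩ := hL.getElem (hget v)
    have hm : ∀ {x : Vertex ℕ} {n : ℕ} {i j : ℕ}, i = j → x ∈ candidates (L.take n) i →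
        x ∈ candidates L j := fun h => candidates_mono (List.take_prefix _ _) h.le
    by_contra! hcon
    have e1 := toVertex_inj (hm hidx h1) (hm rfl h1') hcon.1
    have e2 := toVertex_inj (hm hidx h2) (hm rfl h2') hcon.2
    refine huv (Fin.ext ?_)
    -- Equal index and equal children give equal triples, and triples do not repeat in the list, so
    -- the two positions coincide.
    have hn := hL.nodup_triples
    refine (hn.getElem_inj_iff (hi := by simp) (hj := by simp)).1 ?_
    simp [hidx, e1, e2]
  · obtain ⟨h0, h1, h2, -⟩ := hL.getElem (hget v)
    rw [toAutomaton_idx (hget v)]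
    cases α
    · rw [toAutomaton_low (hget v)]; exact index_toVertex_lt h0 h1
    · rw [toAutomaton_high (hget v)]; exact index_toVertex_lt h0 h2
  · rw [hroot]
    cases q with
    | sink b =>
      refine iff_of_false ?_ (by simp)
      push Not
      -- Node `0` has no nodes before it, so its two distinct children are the two sinks; hence
      -- neither sink is a source.
      obtain ⟨-, h1, h2, h3, -⟩ := hL.getElem (hget ⟨0, hpos⟩)
      rw [List.take_zero, mem_candidates] at h1 h2
      obtain ⟨b1, h1⟩ := h1.resolve_right (by simp)
      obtain ⟨b2, h2⟩ := h2.resolve_right (by simp)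
      have e1 := toAutomaton_low (hget ⟨0, hpos⟩)
      have e2 := toAutomaton_high (hget ⟨0, hpos⟩)
      rw [h1] at e1 h3
      rw [h2] at e2 h3
      have h4 : b1 ≠ b2 := by rintro rfl; exact h3 rfl
      by_cases hb : b1 = b
      · exact ⟨_, _, e1.trans (by rw [hb]; rfl)⟩
      · have : b2 = b := by revert hb h4; cases b <;> cases b1 <;> cases b2 <;> simp
        exact ⟨_, _, e2.trans (by rw [this]; rfl)⟩
    | node u =>
      constructor
      · intro h
        by_contra hne
        have hu : u.1 + 1 < L.length := by
          have := u.2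
          have h' : u.1 ≠ L.length - 1 := fun h' => hne (congrArg _ (Fin.ext h'))
          omega
        obtain ⟨R, hR, h1⟩ := hin u.1 hu
        obtain ⟨j, hj⟩ := List.mem_iff_getElem?.1 hR
        have hjl := (List.getElem?_eq_some_iff.1 hj).1
        rcases h1 with h1 | h1
        · refine h ⟨j, hjl⟩ false ?_
          rw [toAutomaton_low (R := R) hj, h1, toVertex_node u.2]
        · refine h ⟨j, hjl⟩ true ?_
          rw [toAutomaton_high (R := R) hj, h1, toVertex_node u.2]
      · rintro h v α hv
        cases h
        have := hδ v _ α _ hv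
        have := v.2
        omega

theorem poolOf_nil {k : ℕ} (hk : 0 < k) : poolOf [] k = initialPool k := by
  obtain ⟨k, rfl⟩ : ∃ j, k = j + 1 := ⟨k - 1, by omega⟩
  rw [poolOf, List.range_succ_eq_map, initialPool, List.map_cons, List.map_map]
  refine congrArg₂ _ (by simp [countIdx]) ?_
  rw [Nat.add_sub_cancel, List.eq_replicate_iff]
  refine ⟨by simp, fun b hb => ?_⟩
  obtain ⟨a, -, rfl⟩ := List.mem_map.1 hb
  simp [countIdx]

theorem mem_allPlans {m k : ℕ} (hk : 0 < k) {P : Plan} :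
    P ∈ allPlans m k ↔ P.ValidAt [] k ∧ P.skeleton.size = m := by
  change P.Valid _ _ ∧ _ ↔ _
  rw [Plan.ValidAt, poolOf_nil hk]
  have : countIdx [] k = 0 := by simp [countIdx, hk.ne']
  rw [this]

/-- The diagram of a plan. -/
def Plan.toBDD (P : Plan) (m : ℕ) : Automaton (Fin m) := toAutomaton m (build P []).val

theorem length_build_of_mem_allPlans {m k : ℕ} {P : Plan} (hP : P ∈ allPlans m k) :
    (build P []).val.length = m := by
  rw [length_build, hP.2, List.length_nil, zero_add]

theorem isBDD_toBDD {m k : ℕ} (hk : 0 < k) {P : Plan} (hP : P ∈ allPlans m k) :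
    IsBDD k (P.toBDD m) := by
  obtain rfl := length_build_of_mem_allPlans hP
  obtain ⟨h1, h2, h3, h4⟩ := build_valid .nil hk ((mem_allPlans hk).1 hP).1
  refine isBDD_toAutomaton h1 h2 (fun R hR => ?_) fun j hj => h4 j (Nat.zero_le _) hj
  obtain ⟨j, hj⟩ := List.mem_iff_getElem?.1 hR
  exact h3 j R (Nat.zero_le _) hj

/-! ### The plan of a diagram -/

open Classical in
/-- The position of a node in a list. -/
noncomputable def position {V : Type*} (D : List V) (v : V) : ℕ := D.idxOf v

/-- The record of a node when the nodes are numbered by their positions in `D`. -/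
noncomputable def recordOf {V : Type*} (A : Automaton V) (D : List V) (v : V) : Record :=
  ⟨A.idx v, (A.δ v false).map (position D), (A.δ v true).map (position D)⟩

/-- The records of the nodes of `D`. -/
noncomputable def records {V : Type*} (A : Automaton V) (D : List V) : List Record :=
  D.map (recordOf A D)

open Classical in
/-- Depth-first search from `q`, where `D` lists the finished nodes in postorder: the plan of the
tree found, and the updated list. -/
noncomputable def encode {V : Type*} {k : ℕ} (A : Automaton V) (hA : IsBDD k A) :
    Vertex V → List V → Plan × List V
  | .sink _, D => (.nil, D)
  | .node v, D =>
    if v ∈ D then (.nil, D)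
    else
      let lo := encode A hA (A.δ v false) D
      let hi := encode A hA (A.δ v true) lo.2
      (.node (A.idx v) (choice (A.idx v) ((A.δ v false).map (position hi.2))
        ((A.δ v true).map (position hi.2)) lo.1 hi.1 (records A lo.2)) lo.1 hi.1, hi.2 ++ [v])
termination_by q _ => A.index q
decreasing_by
  · exact hA.decreasing v false
  · exact hA.decreasing v true

section
variable {V : Type*} {k : ℕ} {A : Automaton V} (hA : IsBDD k A)

theorem encode_sink (b : Bool) (D : List V) : encode A hA (.sink b) D = (.nil, D) := by
  rw [encode]

theorem encode_of_mem {v : V} {D : List V} (h : v ∈ D) :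
    encode A hA (.node v) D = (.nil, D) := by
  rw [encode, if_pos h]

theorem encode_of_not_mem {v : V} {D : List V} (h : v ∉ D) :
    encode A hA (.node v) D =
      let lo := encode A hA (A.δ v false) D
      let hi := encode A hA (A.δ v true) lo.2
      (.node (A.idx v) (choice (A.idx v) ((A.δ v false).map (position hi.2))
        ((A.δ v true).map (position hi.2)) lo.1 hi.1 (records A lo.2)) lo.1 hi.1,
        hi.2 ++ [v]) := by
  rw [encode, if_neg h]

/-- Induction over the vertices of a diagram, from the sinks to the root. -/
theorem IsBDD.vertex_induction {motive : Vertex V → Prop} (hA : IsBDD k A)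
    (sink : ∀ b, motive (.sink b))
    (node : ∀ v, (∀ α, motive (A.δ v α)) → motive (.node v)) (q : Vertex V) : motive q := by
  induction hn : A.index q using Nat.strong_induction_on generalizing q with
  | _ n ih =>
    cases q with
    | sink b => exact sink b
    | node v => exact node v fun α => ih _ (hn ▸ hA.decreasing v α) _ rfl

theorem prefix_encode (q : Vertex V) : ∀ D : List V, D <+: (encode A hA q D).2 := by
  induction q using hA.vertex_induction with
  | sink b => intro D; rw [encode_sink]
  | node v ih =>
    intro D
    by_cases h : v ∈ D
    · rw [encode_of_mem hA h]
    · rw [encode_of_not_mem hA h]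
      exact ((ih false D).trans (ih true _)).trans (List.prefix_append _ _)

theorem index_le_of_mem_encode (q : Vertex V) : ∀ (D : List V), ∀ u ∈ (encode A hA q D).2,
    u ∈ D ∨ A.idx u ≤ A.index q := by
  induction q using hA.vertex_induction with
  | sink b => intro D u hu; rw [encode_sink] at hu; exact Or.inl hu
  | node v ih =>
    intro D u hu
    by_cases h : v ∈ D
    · rw [encode_of_mem hA h] at hu; exact Or.inl hu
    · rw [encode_of_not_mem hA h] at hu
      rcases List.mem_append.1 hu with hu | hu
      · rcases ih true _ u hu with hu | hu
        · exact (ih false _ u hu).imp id fun h => h.trans (hA.decreasing v false).le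
        · exact Or.inr (hu.trans (hA.decreasing v true).le)
      · rw [List.mem_singleton.1 hu]; exact Or.inr le_rfl

/-- `dfs` marks nodes in preorder and `encode` in postorder. The lists may differ by ancestors of
`q`, but these have larger index than `q` and cannot be met below it; agreement on indices up to
that of `q` is the invariant. -/
theorem dfs_eq_encode (q : Vertex V) : ∀ seen D : List V, D ⊆ seen →
    (∀ u, A.idx u ≤ A.index q → (u ∈ seen ↔ u ∈ D)) →
    (dfs A hA q seen).1 = (encode A hA q D).1.skeleton ∧
      ∀ u, u ∈ (dfs A hA q seen).2 ↔ u ∈ seen ∨ u ∈ (encode A hA q D).2 := by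
  induction q using hA.vertex_induction with
  | sink b =>
    intro seen D hD h
    rw [encode_sink, dfs]
    exact ⟨rfl, fun u => ⟨Or.inl, fun h => h.elim id fun h => hD h⟩⟩
  | node v ih =>
    intro seen D hD h
    by_cases hv : v ∈ D
    · rw [encode_of_mem hA hv, dfs, if_pos (hD hv)]
      exact ⟨rfl, fun u => ⟨Or.inl, fun h => h.elim id fun h => hD h⟩⟩
    · have hv' : v ∉ seen := fun h' => hv ((h v le_rfl).1 h')
      rw [encode_of_not_mem hA hv, dfs, if_neg hv']
      have hne : ∀ u α, A.idx u ≤ A.index (A.δ v α) → u ≠ v := by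
        rintro u α h1 rfl
        exact absurd (hA.decreasing u α) (by omega)
      have hlt : ∀ u α, A.idx u ≤ A.index (A.δ v α) → A.idx u ≤ A.idx v := fun u α h1 =>
        h1.trans (hA.decreasing v α).le
      obtain ⟨l1, l2⟩ := ih false (v :: seen) D (fun u hu => List.mem_cons_of_mem _ (hD hu))
        (fun u hu => by
          rw [List.mem_cons, or_iff_right (hne u _ hu)]
          exact h u (hlt u _ hu))
      have p1 := prefix_encode hA (A.δ v false) D
      have p2 := prefix_encode hA (A.δ v true) (encode A hA (A.δ v false) D).2
      obtain ⟨r1, r2⟩ := ih true (dfs A hA (A.δ v false) (v :: seen)).2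
        (encode A hA (A.δ v false) D).2 (fun u hu => (l2 u).2 (Or.inr hu))
        (fun u hu => by
          rw [l2, List.mem_cons, or_iff_right (hne u _ hu), h u (hlt u _ hu)]
          exact ⟨fun h => h.elim (fun h => p1.subset h) id, Or.inr⟩)
      refine ⟨?_, fun u => ?_⟩
      · simp only [Plan.skeleton, l1, r1]
      · simp only [r2, l2, List.mem_cons, List.mem_append, List.not_mem_nil, or_false]
        have := @p2.subset _ _ _ u
        tauto

theorem spine_eq : spine A hA = (encode A hA A.root []).1.skeleton :=
  (dfs_eq_encode hA A.root [] [] (List.Subset.refl _) fun _ _ => Iff.rfl).1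

/-! ### Correctness of the plan read off a diagram -/

/-- The children of finished nodes are finished. -/
def Closed (A : Automaton V) (D : List V) : Prop :=
  ∀ v ∈ D, ∀ α u, A.δ v α = .node u → u ∈ D

theorem position_append {D : List V} {v : V} (h : v ∈ D) (E : List V) :
    position (D ++ E) v = position D v := by
  classical
  unfold position
  exact List.idxOf_append_of_mem h

theorem map_position_append {D : List V} {q : Vertex V} (h : ∀ u, q = .node u → u ∈ D)
    (E : List V) : q.map (position (D ++ E)) = q.map (position D) := by
  cases q with
  | sink b => rfl
  | node u => simp only [Vertex.map, position_append (h u rfl)]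

theorem map_position_inj {D : List V} {q q' : Vertex V} (h : ∀ u, q = .node u → u ∈ D)
    (he : q.map (position D) = q'.map (position D)) : q = q' := by
  classical
  cases q <;> cases q' <;> simp only [Vertex.map, Vertex.sink.injEq, Vertex.node.injEq,
    reduceCtorEq] at he ⊢
  · exact he
  · exact (List.idxOf_inj (h _ rfl)).1 he

theorem recordOf_append {D : List V} {v : V} (h : ∀ α u, A.δ v α = .node u → u ∈ D)
    (E : List V) : recordOf A (D ++ E) v = recordOf A D v := by
  simp only [recordOf, map_position_append (h _)]

theorem records_append {D : List V} (h : Closed A D) (E : List V) :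
    records A (D ++ E) = records A D ++ E.map (recordOf A (D ++ E)) := by
  rw [records, List.map_append]
  congr 1
  exact List.map_congr_left fun v hv => recordOf_append (h v hv) E

theorem getElem_records {D : List V} {u : V} (h : u ∈ D) :
    (records A D)[position D u]? = some (recordOf A D u) := by
  classical
  unfold records position
  rw [List.getElem?_map, List.getElem?_eq_getElem (List.idxOf_lt_length_of_mem h)]
  simp

theorem map_position_mem_candidates {D : List V} {q : Vertex V} {i : ℕ}
    (h : ∀ u, q = .node u → u ∈ D) (hi : A.index q < i) :
    q.map (position D) ∈ candidates (records A D) i := by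
  rw [mem_candidates]
  cases q with
  | sink b => exact Or.inl ⟨b, rfl⟩
  | node u => exact Or.inr ⟨_, _, rfl, getElem_records (h u rfl), hi⟩

theorem lastNode_records {E : List V} {u : V} (h : (E ++ [u]).Nodup) :
    lastNode (records A (E ++ [u])) = .node (position (E ++ [u]) u) := by
  classical
  have hu : u ∉ E := fun hu => by simp [List.nodup_append', hu] at h
  simp [lastNode, records, position, List.idxOf_append_of_notMem hu]

/-- The invariant of the list of finished nodes. -/
structure Finished (A : Automaton V) (D : List V) : Prop where
  nodup : D.Nodup
  closed : Closed A D
  wellFormed : WellFormed (records A D)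

/-- Replaying the recorded plan with `build` reproduces the records of the visited nodes. In the
final alternative, either nothing new is found, or `q` is a new node, its plan is valid, and it is
finished last; this tells a half edge from a tree edge. -/
theorem encode_spec (q : Vertex V) : ∀ D : List V, Finished A D →
    Finished A (encode A hA q D).2 ∧ (∀ v, q = .node v → v ∈ (encode A hA q D).2) ∧
    (build (encode A hA q D).1 (records A D)).val = records A (encode A hA q D).2 ∧
    (((encode A hA q D).1 = .nil ∧ (encode A hA q D).2 = D) ∨
      ∃ v E, q = .node v ∧ v ∉ D ∧ (encode A hA q D).1.ValidAt (records A D) (A.idx v) ∧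
        (encode A hA q D).2 = E ++ [v]) := by
  induction q using hA.vertex_induction with
  | sink b =>
    intro D hD
    rw [encode_sink]
    exact ⟨hD, fun v h => (by cases h), build_nil _, Or.inl ⟨rfl, rfl⟩⟩
  | node v ih =>
    intro D hD
    by_cases hv : v ∈ D
    · rw [encode_of_mem hA hv]
      exact ⟨hD, fun u h => by cases h; exact hv, build_nil _, Or.inl ⟨rfl, rfl⟩⟩
    have hlo := index_le_of_mem_encode hA (A.δ v false) D
    have hhi := index_le_of_mem_encode hA (A.δ v true) (encode A hA (A.δ v false) D).2
    have pre := prefix_encode hA (A.δ v true) (encode A hA (A.δ v false) D).2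
    obtain ⟨l1, l2, l3, l4⟩ := ih false D hD
    obtain ⟨r1, r2, r3, r4⟩ := ih true _ l1
    rw [encode_of_not_mem hA hv]
    dsimp only
    set l := (encode A hA (A.δ v false) D).1
    set D₁ := (encode A hA (A.δ v false) D).2
    set h := (encode A hA (A.δ v true) D₁).1
    set D₂ := (encode A hA (A.δ v true) D₁).2
    set x := (A.δ v false).map (position D₂) with hx
    set y := (A.δ v true).map (position D₂) with hy
    have d1 := hA.decreasing v false
    have d2 := hA.decreasing v true
    -- Below the children only nodes of index smaller than that of `v` are added.
    have hv₂ : v ∉ D₂ := by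
      intro h
      rcases hhi v h with h | h
      · rcases hlo v h with h | h
        · exact hv h
        · omega
      · omega
    have hpos : 0 < A.idx v := by omega
    have hcl : ∀ α u, A.δ v α = .node u → u ∈ D₂ := by
      intro α u hu
      cases α
      · exact pre.subset (l2 u hu)
      · exact r2 u hu
    have hx₁ : x = (A.δ v false).map (position D₁) := by
      obtain ⟨E, hE⟩ := pre
      rw [hx, ← hE, map_position_append l2]
    have hnil : h = .nil → D₂ = D₁ := by
      intro hn
      rcases r4 with h' | ⟨_, _, -, -, h', -⟩
      · exact h'.2
      · rw [hn] at h'; exact h'.elim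
    have hch : IsChildren (A.idx v) x y l h (records A D₁) (records A D₂) := by
      refine ⟨map_position_mem_candidates (hcl false) d1,
        map_position_mem_candidates (hcl true) d2,
        fun h => hA.low_ne_high v (map_position_inj (hcl false) h), ?_, fun hn => ?_, fun hn => ?_,
        fun hn => ?_, fun hn => ?_⟩
      -- A finished node with the same triple would have the same index and, since positions are
      -- injective on finished nodes, the same children as `v`.
      · intro hm
        rw [records, List.map_map] at hm
        obtain ⟨u, hu, h⟩ := List.mem_map.1 hm
        simp only [Function.comp, recordOf, Prod.mk.injEq] at h
        have huv : u ≠ v := by rintro rfl; exact hv₂ hu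
        rcases hA.unshared u v huv h.1 with h' | h'
        · exact h' (map_position_inj (r1.closed u hu false) h.2.1)
        · exact h' (map_position_inj (r1.closed u hu true) h.2.2)
      · rw [hx₁]
        exact map_position_mem_candidates l2 d1
      · obtain ⟨u, E, hu, -, -, hE⟩ := l4.resolve_left fun h' => hn h'.1
        have := l1.nodup
        rw [hx₁, hE] at *
        rw [lastNode_records this, hu]
        rfl
      · have hyc : y ∈ candidates (records A D₂) (A.idx v) :=
          map_position_mem_candidates (hcl true) d2
        rwa [hnil hn] at hyc
      · obtain ⟨u, E, hu, -, -, hE⟩ := r4.resolve_left fun h' => hn h'.1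
        have := r1.nodup
        rw [hE] at this
        rw [hy, hE, lastNode_records this, hu]
        rfl
    obtain ⟨c1, c2⟩ := choice_lt hch fun hn => by rw [hnil hn]
    have hval : (Plan.node (A.idx v) (choice (A.idx v) x y l h (records A D₁)) l h).ValidAt
        (records A D) (A.idx v) := by
      refine (Plan.validAt_node hpos hD.wellFormed fun j hj hjv =>
        (build_valid hD.wellFormed hj hjv).2.1).2 ⟨rfl, ?_, ?_, ?_⟩
      · rcases l4 with h' | ⟨u, E, hu, -, h', -⟩
        · exact Or.inl h'.1
        · refine Or.inr ⟨A.idx u, by rw [hu] at d1; exact d1, ?_, h'⟩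
          exact (hA.decreasing u true).pos
      · rw [l3]
        rcases r4 with h' | ⟨u, E, hu, -, h', -⟩
        · exact Or.inl h'.1
        · exact Or.inr ⟨A.idx u, by rw [hu] at d2; exact d2, (hA.decreasing u true).pos, h'⟩
      · rw [l3]; exact c1
    have hrec : records A (D₂ ++ [v]) = records A D₂ ++ [⟨A.idx v, x, y⟩] := by
      rw [records_append r1.closed, List.map_singleton, recordOf_append hcl]
      rfl
    have hbuild : (build (.node (A.idx v) (choice (A.idx v) x y l h (records A D₁)) l h)
        (records A D)).val = records A (D₂ ++ [v]) := by
      rw [build_node, l3, r3, c2, hrec]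
    refine ⟨⟨?_, ?_, ?_⟩, ?_, hbuild, Or.inr ⟨v, D₂, rfl, hv, hval, rfl⟩⟩
    · rw [List.nodup_append']
      exact ⟨r1.nodup, by simp, by simpa using hv₂⟩
    · intro u hu α w hw
      rw [List.mem_append, List.mem_singleton] at hu
      refine List.mem_append_left _ ?_
      rcases hu with hu | rfl
      · exact r1.closed u hu α w hw
      · exact hcl α w hw
    · rw [← hbuild]
      exact (build_valid hD.wellFormed hpos hval).1
    · intro u hu
      cases hu
      simp

theorem finished_nil : Finished A ([] : List V) :=
  ⟨List.nodup_nil, fun _ h => by simp at h, .nil⟩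

theorem IsBDD.root_eq_node (hA : IsBDD k A) (hk : 0 < k) : ∃ v, A.root = .node v ∧ A.idx v = k := by
  have h := hA.root_index
  revert h
  generalize A.root = q
  intro h
  cases q with
  | sink b => exact absurd h hk.ne
  | node v => exact ⟨v, rfl, h⟩

/-- Every node other than the root has a parent, which has a larger index. Climbing ends at the root
because indices are at most `k`, and the visited nodes are closed under taking children. -/
theorem mem_encode_root (v : V) : v ∈ (encode A hA A.root []).2 := by
  obtain ⟨h1, h2, -, -⟩ := encode_spec hA A.root [] finished_nil
  induction hn : k - A.idx v using Nat.strong_induction_on generalizing v with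
  | _ n ih =>
    by_cases hr : Vertex.node v = A.root
    · exact h2 v hr.symm
    · have h3 : ¬ ∀ u α, A.δ u α ≠ .node v := fun h => hr ((hA.unique_source _).1 h)
      push Not at h3
      obtain ⟨u, α, hu⟩ := h3
      refine h1.closed u (ih _ ?_ u rfl) α v hu
      have := hA.decreasing u α
      rw [hu, Automaton.index] at this
      have := hA.idx_le u
      omega

/-- As all nodes are visited exactly once, listing them in postorder is a bijection with an initial
segment of the numbers, and this is the isomorphism. -/
theorem encode_root_spec [Fintype V] (hk : 0 < k) :
    (encode A hA A.root []).1 ∈ allPlans (Fintype.card V) k ∧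
      Isom ((encode A hA A.root []).1.toBDD (Fintype.card V)) A := by
  classical
  obtain ⟨h1, h2, h3, h4⟩ := encode_spec hA A.root [] finished_nil
  have hmem := mem_encode_root hA
  obtain ⟨v, hv, hvk⟩ := hA.root_eq_node hk
  obtain ⟨v', E, hv', -, hval, hE⟩ := h4.resolve_left fun h => by
    have := hmem v
    rw [h.2] at this
    simp at this
  obtain rfl : v = v' := by rw [hv] at hv'; cases hv'; rfl
  rw [hvk] at hval
  have hcard : (encode A hA A.root []).2.length = Fintype.card V := by
    rw [← List.toFinset_card_of_nodup h1.nodup, ← Finset.card_univ]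
    congr
    ext u
    simp [hmem]
  change (build _ []).val = _ at h3
  rw [Plan.toBDD, h3]
  have hlen := congrArg List.length h3
  rw [length_build, records, List.length_map, hcard, List.length_nil, zero_add] at hlen
  refine ⟨(mem_allPlans hk).2 ⟨hval, hlen⟩, ?_⟩
  generalize encode A hA A.root [] = r at *
  obtain ⟨P, D⟩ := r
  simp only at *
  rw [← hcard]
  have hpos : ∀ u, position D u < D.length := fun u => List.idxOf_lt_length_of_mem (hmem u)
  have hgp : ∀ u, D[position D u]'(hpos u) = u := fun u => List.getElem_idxOf _
  have hrec : ∀ i : Fin D.length, (records A D)[i.1]? = some (recordOf A D D[i.1]) := by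
    intro i
    simp [records]
  have hmap : ∀ q : Vertex V, (toVertex D.length (q.map (position D))).map D.get = q := by
    intro q
    cases q with
    | sink b => rfl
    | node u =>
      rw [Vertex.map, toVertex_node (hpos u), Vertex.map]
      exact congrArg _ (hgp u)
  refine ⟨h1.nodup.getEquivOfForallMemList D hmem, fun i => ?_, ?_, fun i α => ?_⟩
  · rw [toAutomaton_idx (hrec i)]
    rfl
  · have := h1.nodup
    rw [hE] at this
    have hlast := lastNode_records (A := A) this
    rw [← hE, lastNode, records, List.length_map] at hlast
    change A.root = (toVertex D.length (.node (D.length - 1))).map D.get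
    rw [hlast]
    exact hv.trans (hmap (.node v)).symm
  · cases α
    · rw [toAutomaton_low (hrec i)]
      exact (hmap _).symm
    · rw [toAutomaton_high (hrec i)]
      exact (hmap _).symm
end

/-! ### Plans and diagrams up to isomorphism -/

theorem position_map {V W : Type*} (e : V ≃ W) (D : List V) (v : V) :
    position (D.map e) (e v) = position D v := by
  classical
  induction D with
  | nil => rfl
  | cons a D ih =>
    unfold position at ih ⊢
    rw [List.map_cons]
    by_cases h : a = v
    · rw [h, List.idxOf_cons_self, List.idxOf_cons_self]
    · rw [List.idxOf_cons_ne _ h, List.idxOf_cons_ne _ (e.injective.ne h), ih]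

theorem records_map {V W : Type*} {A : Automaton V} {B : Automaton W} (e : V ≃ W)
    (hidx : ∀ v, B.idx (e v) = A.idx v) (hδ : ∀ v α, B.δ (e v) α = (A.δ v α).map e)
    (D : List V) : records B (D.map e) = records A D := by
  rw [records, records, List.map_map]
  refine List.map_congr_left fun v _ => ?_
  have hp : position (D.map e) ∘ e = position D := funext (position_map e D)
  simp only [Function.comp_apply, recordOf, hidx, hδ, Vertex.map_map, hp]

/-- The choices are computed from positions in the list of finished nodes, and a renaming applied to
nodes and list leaves these unchanged. Isomorphic diagrams thus have the same plan. -/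
theorem encode_map {V W : Type*} {k : ℕ} {A : Automaton V} {B : Automaton W} (hA : IsBDD k A)
    (hB : IsBDD k B) (e : V ≃ W) (hidx : ∀ v, B.idx (e v) = A.idx v)
    (hδ : ∀ v α, B.δ (e v) α = (A.δ v α).map e) (q : Vertex V) : ∀ D : List V,
    encode B hB (q.map e) (D.map e) = ((encode A hA q D).1, (encode A hA q D).2.map e) := by
  induction q using hA.vertex_induction with
  | sink b => intro D; rw [Vertex.map, encode_sink, encode_sink]
  | node v ih =>
    intro D
    rw [Vertex.map]
    by_cases hv : v ∈ D
    · rw [encode_of_mem hA hv, encode_of_mem hB (List.mem_map_of_mem hv)]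
    · have hv' : e v ∉ D.map e := by simpa using hv
      rw [encode_of_not_mem hA hv, encode_of_not_mem hB hv']
      have hp : ∀ D : List V, position (D.map e) ∘ e = position D :=
        fun D => funext (position_map e D)
      simp only [hidx, hδ, ih, Vertex.map_map, hp, records_map e hidx hδ, List.map_append,
        List.map_cons, List.map_nil]

theorem encode_eq_of_isom {V W : Type*} {k : ℕ} {A : Automaton V} {B : Automaton W}
    (hA : IsBDD k A) (hB : IsBDD k B) (h : Isom A B) :
    (encode B hB B.root []).1 = (encode A hA A.root []).1 := by
  obtain ⟨e, h1, h2, h3⟩ := h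
  have := encode_map hA hB e h1 h3 A.root []
  rw [h2]
  exact congrArg Prod.fst this

/-! ### Recovering a plan from the diagram built from it -/

theorem position_take_finRange {m d : ℕ} {j : Fin m} (h : j.1 < d) :
    position ((List.finRange m).take d) j = j.1 := by
  classical
  have hj : j ∈ (List.finRange m).take d := by
    rw [List.mem_take_iff_getElem]
    exact ⟨j.1, by simp [h], by simp⟩
  have h1 : position ((List.finRange m).take d ++ (List.finRange m).drop d) j = _ :=
    position_append hj _
  rw [← h1, List.take_append_drop]
  unfold position
  convert List.idxOf_finRange j

theorem mem_take_finRange {m d : ℕ} {j : Fin m} : j ∈ (List.finRange m).take d ↔ j.1 < d := by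
  rw [List.mem_take_iff_getElem]
  constructor
  · rintro ⟨i, hi, rfl⟩
    simp at hi ⊢
    omega
  · intro h
    exact ⟨j.1, by simp [h], by simp⟩

theorem map_position_toVertex {L : List Record} {i d : ℕ} {x : Vertex ℕ}
    (hx : x ∈ candidates (L.take d) i) :
    (toVertex L.length x).map (position ((List.finRange L.length).take d)) = x := by
  rw [mem_candidates] at hx
  rcases hx with ⟨b, rfl⟩ | ⟨j, R, rfl, h, -⟩
  · rfl
  · have hj := (List.getElem?_eq_some_iff.1 h).1
    rw [List.length_take] at hj
    rw [toVertex_node (by omega), Vertex.map, position_take_finRange (by simp only []; omega)]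

/-- Children have smaller numbers than their parents, so the first `d` nodes refer only to one
another and their positions are their original numbers. -/
theorem records_toAutomaton {L : List Record} (hL : WellFormed L) (d : ℕ) :
    records (toAutomaton L.length L) ((List.finRange L.length).take d) = L.take d := by
  refine List.ext_getElem (by simp [records]) fun j h1 h2 => ?_
  have hj : j < d ∧ j < L.length := by simpa using h2
  have hget : L[j]? = some L[j] := List.getElem?_eq_getElem hj.2
  obtain ⟨-, l1, l2, -⟩ := hL.getElem hget
  have hm : ∀ x, x ∈ candidates (L.take j) L[j].idx → x ∈ candidates (L.take d) L[j].idx :=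
    fun x => candidates_mono (List.take_prefix_take_left (by omega)) le_rfl
  have e0 := toAutomaton_idx (v := ⟨j, hj.2⟩) hget
  have e1 := toAutomaton_low (v := ⟨j, hj.2⟩) hget
  have e2 := toAutomaton_high (v := ⟨j, hj.2⟩) hget
  simp only [records, List.getElem_map, List.getElem_take, List.getElem_finRange, recordOf,
    Fin.cast_mk]
  rw [e0, e1, e2, map_position_toVertex (hm _ l1), map_position_toVertex (hm _ l2)]

/-- `build` only appends, so an intermediate result is a prefix of the final list and is determined
by its length. -/
theorem build_take {L : List Record} {P Q : Plan} {d d' : ℕ} (hd : d ≤ L.length)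
    (h : (build Q (build P (L.take d)).val).val <+: L.take d') :
    (build P (L.take d)).val = L.take (d + P.skeleton.size) := by
  have h1 := ((prefix_build Q (build P (L.take d)).val).trans h).trans (List.take_prefix _ _)
  rw [List.prefix_iff_eq_take.1 h1, length_build, List.length_take_of_le hd]

theorem WellFormed.take {L : List Record} (hL : WellFormed L) (d : ℕ) : WellFormed (L.take d) := by
  induction hL with
  | nil => simpa using WellFormed.nil
  | @snoc D R hD h1 h2 h3 h4 h5 ih =>
    by_cases hd : d ≤ D.length
    · rwa [List.take_append_of_le_length hd]
    · rw [List.take_of_length_le (by simp; omega)]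
      exact .snoc hD h1 h2 h3 h4 h5

/-- The search on the finished diagram retraces the construction. The starting list is a prefix of
`L`, so that the induction applies to the left subtree from `d` and to the right subtree from `d₁`.
-/
theorem encode_toAutomaton {L : List Record} (hL : WellFormed L) {k : ℕ}
    (hA : IsBDD k (toAutomaton L.length L)) {P : Plan} :
    ∀ {d i : ℕ}, 0 < i → d + P.skeleton.size ≤ L.length → P.ValidAt (L.take d) i →
      (build P (L.take d)).val = L.take (d + P.skeleton.size) →
      encode (toAutomaton L.length L) hA (toVertex L.length (lastNode (build P (L.take d)).val))
        ((List.finRange L.length).take d) =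
        (P, (List.finRange L.length).take (d + P.skeleton.size)) := by
  induction P with
  | nil => intro d i _ _ h; exact h.elim
  | node i' c l h ihl ihh =>
    intro d i hi hd hP hb
    have hwf : ∀ d, WellFormed (L.take d) := hL.take
    obtain ⟨rfl, hl, hh, hc⟩ := (Plan.validAt_node hi (hwf d) fun j hj hjv =>
        (build_valid (hwf d) hj hjv).2.1).1 hP
    simp only [Plan.skeleton, Spine.size] at hd hb ⊢
    set d₁ := d + l.skeleton.size with hd₁
    set d₂ := d₁ + h.skeleton.size with hd₂
    have hdd : d + (l.skeleton.size + h.skeleton.size + 1) = d₂ + 1 := by omega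
    rw [hdd] at hb hd ⊢
    rw [build_node] at hb
    have hb₁ : (build l (L.take d)).val = L.take d₁ :=
      build_take (Q := h) (by omega) (hb ▸ List.prefix_append _ _)
    rw [hb₁] at hb hh hc
    have hb₂ : (build h (L.take d₁)).val = L.take d₂ :=
      build_take (Q := .nil) (d' := d₂ + 1) (by omega) (by
        rw [build_nil]; exact hb ▸ List.prefix_append _ _)
    rw [hb₂] at hb
    have hnil : h = .nil → d₂ = d₁ := by
      rintro rfl; simp [hd₂, Plan.skeleton, Spine.size]
    have hnil' : l = .nil → d₁ = d := by
      rintro rfl; simp [hd₁, Plan.skeleton, Spine.size]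
    have hch := isChildren_children (D₂ := L.take d₂) hc (fun hn => by rw [hnil hn]) (hwf d₂)
      (List.take_prefix_take_left (by omega))
      (fun hn => by
        obtain ⟨j, hj, hj', hv⟩ := hl.resolve_left hn
        exact ⟨j, hj, hb₁ ▸ (build_valid (hwf d) hj' hv).2.1⟩)
      (fun hn => by
        obtain ⟨j, hj, hj', hv⟩ := hh.resolve_left hn
        refine ⟨?_, j, hj, hb₂ ▸ (build_valid (hwf d₁) hj' hv).2.1⟩
        have : h.skeleton.size ≠ 0 := fun h' =>
          hn (Plan.skeleton_eq_nil.1 (Spine.size_eq_zero.1 h'))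
        rw [List.length_take_of_le (by omega), List.length_take_of_le (by omega)]
        omega)
    have hcc := choice_children hc (L.take d₂)
    generalize children i' c l h (L.take d₁) (L.take d₂) = xy at *
    obtain ⟨x, y⟩ := xy
    simp only at hch hcc hb
    obtain ⟨c1, c2, -, -, c5, c6, c7, c8⟩ := hch
    have hget : L[d₂]? = some ⟨i', x, y⟩ := by
      have h1 : (L.take (d₂ + 1))[d₂]? = L[d₂]? := List.getElem?_take_of_lt (by omega)
      rw [← h1, ← hb, List.getElem?_append_right (by simp)]
      simp [List.length_take_of_le (by omega : d₂ ≤ L.length)]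
    have hlast : lastNode (build (.node i' c l h) (L.take d)).val = .node d₂ := by
      rw [lastNode, length_build, List.length_take_of_le (by omega), Plan.skeleton, Spine.size]
      congr 1
      omega
    -- A half edge leads to a sink or to a finished node, where the search stops at once with an
    -- empty plan.
    have enc_old : ∀ {x : Vertex ℕ} {n : ℕ}, x ∈ candidates (L.take n) i' →
        encode (toAutomaton L.length L) hA (toVertex L.length x)
          ((List.finRange L.length).take n) = (.nil, (List.finRange L.length).take n) := by
      intro x n hx
      rw [mem_candidates] at hx
      rcases hx with ⟨b, rfl⟩ | ⟨j, R, rfl, h, -⟩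
      · exact encode_sink hA b _
      · have hj := (List.getElem?_eq_some_iff.1 h).1
        rw [List.length_take] at hj
        rw [toVertex_node (by omega)]
        exact encode_of_mem hA (mem_take_finRange.2 (by simp only []; omega))
    have hlo : encode (toAutomaton L.length L) hA (toVertex L.length x)
        ((List.finRange L.length).take d) = (l, (List.finRange L.length).take d₁) := by
      by_cases hn : l = .nil
      · rw [hnil' hn] at c5 ⊢
        rw [enc_old (c5 hn), hn]
      · obtain ⟨j, hj, hj', hv⟩ := hl.resolve_left hn
        rw [c6 hn, ← hb₁]
        exact ihl hj' (by omega) hv hb₁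
    have hhi : encode (toAutomaton L.length L) hA (toVertex L.length y)
        ((List.finRange L.length).take d₁) = (h, (List.finRange L.length).take d₂) := by
      by_cases hn : h = .nil
      · rw [hnil hn] at *
        rw [enc_old (c7 hn), hn]
      · obtain ⟨j, hj, hj', hv⟩ := hh.resolve_left hn
        rw [c8 hn, ← hb₂]
        exact ihh hj' (by omega) hv hb₂
    rw [hlast, toVertex_node (by omega), encode_of_not_mem hA (by
      rw [mem_take_finRange]; simp only []; omega), toAutomaton_idx (v := ⟨d₂, by omega⟩) hget,
      toAutomaton_low (v := ⟨d₂, by omega⟩) hget, toAutomaton_high (v := ⟨d₂, by omega⟩) hget]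
    simp only [hlo, hhi, records_toAutomaton hL, map_position_toVertex c1,
      map_position_toVertex c2, hcc]
    rw [List.take_succ_eq_append_getElem (by simp; omega)]
    simp

theorem encode_toBDD {m k : ℕ} (hk : 0 < k) {P : Plan} (hP : P ∈ allPlans m k)
    (hA : IsBDD k (P.toBDD m)) : (encode (P.toBDD m) hA (P.toBDD m).root []).1 = P := by
  obtain rfl := length_build_of_mem_allPlans hP
  obtain ⟨h1, h2⟩ := (mem_allPlans hk).1 hP
  have hw := (build_valid .nil hk h1).1
  have := encode_toAutomaton hw hA (P := P) (d := 0) hk (by omega) h1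
    (by rw [List.take_zero, zero_add, h2, List.take_length])
  exact congrArg Prod.fst this

theorem toBDD_inj {m k : ℕ} (hk : 0 < k) {P Q : Plan} (hP : P ∈ allPlans m k)
    (hQ : Q ∈ allPlans m k) (h : Isom (P.toBDD m) (Q.toBDD m)) : P = Q := by
  have hA := isBDD_toBDD hk hP
  have hB := isBDD_toBDD hk hQ
  rw [← encode_toBDD hk hP hA, ← encode_toBDD hk hQ hB, encode_eq_of_isom hA hB h]

/-- This turns the cost bound in terms of spines of plans into one in terms of `validSpines`. -/
theorem validSpines_eq {m k : ℕ} (hk : 0 < k) :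
    validSpines m k = Plan.skeleton '' allPlans m k := by
  ext T
  constructor
  · rintro ⟨rfl, V, _, A, hA, rfl⟩
    have h := (encode_root_spec hA hk).1
    rw [spine_eq, h.2]
    exact ⟨_, h, rfl⟩
  · rintro ⟨P, hP, rfl⟩
    have hA := isBDD_toBDD hk hP
    exact ⟨hP.2, Fin m, inferInstance, P.toBDD m, hA, by rw [spine_eq, encode_toBDD hk hP hA]⟩

/-! ### The unranking algorithm -/

theorem unrank_val (n k r : ℕ) : (unrank n k r).val =
    (unrankAny (n - 2) (initialPool k) 0 r).val.toBDD (n - 2) := by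
  unfold unrank unrankAny
  rcases h : select Prod.snd (count (n - 2) (initialPool k) 0) r with ⟨_ | ⟨e, r'⟩, c⟩ <;> rfl

theorem unrank_ops_le (n k r : ℕ) : (unrank n k r).ops ≤
    (unrankAny (n - 2) (initialPool k) 0 r).ops +
      2 * (unrankAny (n - 2) (initialPool k) 0 r).val.skeleton.size := by
  unfold unrank unrankAny
  rcases h : select Prod.snd (count (n - 2) (initialPool k) 0) r with ⟨_ | ⟨e, r'⟩, c⟩
  · exact Nat.le_add_right _ _
  · simp only [Cost.ops_bind, Cost.val_bind, Cost.ops_pure, add_zero, ← add_assoc]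
    exact Nat.add_le_add_left (ops_build_le _ _) _

theorem bijOn_unrank_plans (n k : ℕ) :
    Set.BijOn (fun r => (unrankAny (n - 2) (initialPool k) 0 r).val)
      (Set.Iio (countSum (n - 2) (initialPool k) 0)) (allPlans (n - 2) k) :=
  bijOn_unrankAny _ _ _

theorem isBDD_unrank {n k r : ℕ} (hk : 0 < k) (hr : r < countSum (n - 2) (initialPool k) 0) :
    IsBDD k (unrank n k r).val := by
  rw [unrank_val]
  exact isBDD_toBDD hk ((bijOn_unrank_plans n k).mapsTo hr)

theorem exists_unrank_isom {n k : ℕ} (hk : 0 < k) {V : Type*} [Fintype V] {A : Automaton V}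
    (hA : IsBDD k A) (hV : Fintype.card V + 2 = n) :
    ∃ r < countSum (n - 2) (initialPool k) 0, Isom (unrank n k r).val A := by
  obtain ⟨h1, h2⟩ := encode_root_spec hA hk
  have hn : Fintype.card V = n - 2 := by omega
  rw [hn] at h1 h2
  obtain ⟨r, hr, h⟩ := (bijOn_unrank_plans n k).surjOn h1
  refine ⟨r, hr, ?_⟩
  rw [unrank_val]
  dsimp only at h
  rw [h]
  exact h2

theorem unrank_inj {n k r r' : ℕ} (hk : 0 < k) (hr : r < countSum (n - 2) (initialPool k) 0)
    (hr' : r' < countSum (n - 2) (initialPool k) 0)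
    (h : Isom (unrank n k r).val (unrank n k r').val) : r = r' := by
  rw [unrank_val, unrank_val] at h
  have hb := bijOn_unrank_plans n k
  exact hb.injOn hr hr' (toBDD_inj hk (hb.mapsTo hr) (hb.mapsTo hr') h)

/-- Unranking itself is the bijection from the ranks below the total weight to the isomorphism
classes. -/
theorem numBDD_eq {n k : ℕ} (hk : 0 < k) :
    numBDD n k = countSum (n - 2) (initialPool k) 0 := by
  rw [numBDD, ← Nat.card_fin (countSum (n - 2) (initialPool k) 0)]
  refine (Nat.card_eq_of_bijective (fun r : Fin (countSum (n - 2) (initialPool k) 0) =>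
    (Quotient.mk (bddSetoid n k) ⟨(unrank n k r).val, isBDD_unrank hk r.2⟩)) ⟨?_, ?_⟩).symm
  · intro r r' h
    exact Fin.ext (unrank_inj hk r.2 r'.2 (Quotient.exact h))
  · intro q
    induction q using Quotient.inductionOn with
    | _ A =>
      obtain ⟨A, hA⟩ := A
      obtain ⟨v, -⟩ := hA.root_eq_node hk
      -- The root is a decision node, so the subtraction in `n - 2` is not truncated.
      have hn : 0 < n - 2 := v.pos
      obtain ⟨r, hr, h⟩ := exists_unrank_isom (n := n) hk hA (by rw [Fintype.card_fin]; omega)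
      exact ⟨⟨r, hr⟩, Quotient.sound h⟩

/-- With `m = n - 2` and `N` spines, unranking the plan costs at most `(6 * m + 2) * N` and building
at most `2 * m`. Since a rank exists, `N` is positive, and the sum is at most `8 * (n * N)`. -/
theorem unrank_ops_le_ncard {n k r : ℕ} (hk : 0 < k) (hr : r < numBDD n k) :
    (unrank n k r).ops ≤ 8 * (n * (validSpines (n - 2) k).ncard) := by
  rw [numBDD_eq hk] at hr
  have hb := bijOn_unrank_plans n k
  have hP := hb.mapsTo hr
  have h1 := unrank_ops_le n k r
  have h2 := ops_unrankAny_le _ _ _ r hr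
  have h3 : (unrankAny (n - 2) (initialPool k) 0 r).val.skeleton.size = n - 2 := hP.2
  rw [h3] at h1
  change _ ≤ _ * (Plan.skeleton '' allPlans (n - 2) k).ncard at h2
  rw [← validSpines_eq hk] at h2
  have h4 : 0 < (validSpines (n - 2) k).ncard := by
    have hfin : (allPlans (n - 2) k).Finite := hb.image_eq ▸ (Set.finite_Iio _).image _
    rw [validSpines_eq hk, Set.ncard_pos (hfin.image _)]
    exact ⟨_, _, hP, rfl⟩
  have h5 : n - 2 ≠ 0 := by
    intro h0
    exact Plan.Valid.ne_nil hP.1 (Plan.skeleton_eq_nil.1 (Spine.size_eq_zero.1 (h3.trans h0)))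
  generalize (validSpines (n - 2) k).ncard = N at *
  obtain ⟨m, rfl⟩ : ∃ m, n = m + 2 := ⟨n - 2, by omega⟩
  simp only [Nat.add_sub_cancel] at *
  nlinarith [Nat.le_mul_of_pos_right m h4]

/-! ### The sampler and the main statement -/

theorem sampler_eq (n k : ℕ) (h : 0 < numBDD n k)
    (h' : (Finset.range (numBDD n k)).Nonempty) :
    sampler n k h = (PMF.uniformOfFinset (Finset.range (numBDD n k)) h').map
      fun r => unrank n k r := rfl

theorem mainTheorem7 :
    ∃ C : ℕ, ∀ n k : ℕ, 1 ≤ k →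
      (∀ r < numBDD n k, IsBDD k (unrank n k r).val ∧
        (unrank n k r).ops ≤ C * (n * (validSpines (n - 2) k).ncard)) ∧
      (∀ (V : Type) [Fintype V] (A : Automaton V), IsBDD k A → Fintype.card V + 2 = n →
        ∃! r : ℕ, r < numBDD n k ∧ Isom (unrank n k r).val A) ∧
      (∀ h : 0 < numBDD n k,
        (∀ x ∈ (sampler n k h).support, IsBDD k x.val ∧
          x.ops ≤ C * (n * (validSpines (n - 2) k).ncard)) ∧
        ∀ (V : Type) [Fintype V] (A : Automaton V), IsBDD k A → Fintype.card V + 2 = n →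
          ((sampler n k h).map Cost.val).toOuterMeasure {B | Isom B A} =
            (numBDD n k : ENNReal)⁻¹) := by
  refine ⟨8, fun n k hk => ?_⟩
  have h1 : ∀ r < numBDD n k, IsBDD k (unrank n k r).val ∧
      (unrank n k r).ops ≤ 8 * (n * (validSpines (n - 2) k).ncard) := fun r hr =>
    ⟨isBDD_unrank hk (numBDD_eq hk ▸ hr), unrank_ops_le_ncard hk hr⟩
  have h2 : ∀ (V : Type) [Fintype V] (A : Automaton V), IsBDD k A → Fintype.card V + 2 = n →
      ∃! r : ℕ, r < numBDD n k ∧ Isom (unrank n k r).val A := by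
    intro V _ A hA hV
    rw [numBDD_eq hk]
    obtain ⟨r, hr, h⟩ := exists_unrank_isom hk hA hV
    exact ⟨r, ⟨hr, h⟩, fun r' hr' => unrank_inj hk hr'.1 hr (hr'.2.trans h.symm)⟩
  refine ⟨h1, h2, fun h => ?_⟩
  have hne : (Finset.range (numBDD n k)).Nonempty := ⟨0, Finset.mem_range.2 h⟩
  rw [sampler_eq n k h hne]
  refine ⟨fun x hx => ?_, fun V _ A hA hV => ?_⟩
  · rw [PMF.mem_support_map_iff] at hx
    obtain ⟨r, hr, rfl⟩ := hx
    rw [PMF.mem_support_uniformOfFinset_iff, Finset.mem_range] at hr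
    exact h1 r hr
  · classical
    obtain ⟨r, hr, huniq⟩ := h2 V A hA hV
    rw [PMF.map_comp, PMF.toOuterMeasure_map_apply,
      PMF.toOuterMeasure_uniformOfFinset_apply]
    -- The event of obtaining a diagram isomorphic to `A` pulls back to a single rank, and each rank
    -- has probability `1 / numBDD n k`.
    have : (Finset.range (numBDD n k)).filter (fun x =>
        x ∈ (Cost.val ∘ fun r => unrank n k r) ⁻¹' {B | Isom B A}) = {r} := by
      ext r'
      rw [Finset.mem_filter, Finset.mem_range, Finset.mem_singleton]
      exact ⟨fun h' => huniq r' h', fun h' => h' ▸ hr⟩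
    rw [this, Finset.card_singleton, Finset.card_range, Nat.cast_one, one_div]
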